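/- **Setting.** Let $\Pi$ be a finite set of atomic propositions. A weighted transition system $\mathcal T=(Q,q_0,R,\Pi,\mathcal L,w)$ consists of a finite set of states $Q$, an initial state $q_0$, a transition relation $R\subseteq Q\times Q$ such that every state has an outgoing transition, a labeling $\mathcal L:Q\to 2^\Pi$, and weights $w:R\to\mathbb R_{>0}$. A run is an infinite sequence $r=r_0r_1r_2\dots$ with $r_0=q_0$ and $(r_i,r_{i+1})\in R$ for all $i$; it satisfies an LTL formula $\phi$ if its word $\mathcal L(r_0)\mathcal L(r_1)\dots$ does. Its times are $t_0=0$, $t_{i+1}=t_i+w(r_i,r_{i+1})$. For $\pi\in\Pi$, let $\mathbb T_\pi(0)<\mathbb T_\pi(1)<\cdots$ be the times $t_i$ with $\pi\in\mathcal L(r_i)$. The cost of a run on which $\pi$ holds infinitely often is $\mathcal C(r)=\limsup_{i\to\infty}\big(\mathbb T_\pi(i+1)-\mathbb T_\pi(i)\big)\in[0,+\infty]$. **Algorithm (Optimal-Run).** The input is $\mathcal T$ and a formula $\phi=\varphi\wedge\mathbf G\mathbf F\,\pi$, with $\varphi$ an LTL formula over $\Pi$. 1. Translate $\phi$ into a Büchi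 automaton $\mathcal B=(S,S_0,2^\Pi,\delta,F)$ that accepts exactly the infinite words satisfying $\phi$. 2. Form the product $\mathcal P$ with states $Q\times S$, initial states $\{q_0\}\times S_0$, a transition from $(q,s)$ to $(\bar q,\bar s)$ of weight $w(q,\bar q)$ iff $(q,\bar q)\in R$ and $(s,\mathcal L(q),\bar s)\in\delta$, and accepting states $Q\times F$. Let $S_\pi=\{(q,s):\pi\in\mathcal L(q)\}$, and let $F'$ be the set of accepting states that are reachable from an initial state. 3. Run Min-Bottleneck-Cycle on $\mathcal P$ with the vertex sets $S_\pi$ and $F'$: - Compute shortest-path distances $D$ by Dijkstra's algorithm; here the distance from a vertex to itself is the length of a shortest cycle through it, and missing paths have distance $+\infty$. - Let $G_{S_\pi}$ be the graph on $S_\pi$ with edge lengths $D$, and compute in it, by Dijkstra's algorithm with maximum in place of sum, the least possible maximum edge length $D_{\mathrm{bot}}(s_1,s_2)$ of a path with at least one edge from $s_1$ to $s_2$. - Let $D_0(u,v)=0$ if $u=v$ and $D_0(u,v)=D(u,v)$ otherwise. For $(f,s_1,s_2)\in F'\times S_\pi\times S_\pi$, let $C(f,s_1,s_2)=D_0(f,s_1)+D_0(s_2,f)$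 if $f\ne s_1=s_2$, and $C(f,s_1,s_2)=\max\{D_0(f,s_1)+D_0(s_2,f),\,D_{\mathrm{bot}}(s_1,s_2)\}$ otherwise. - Take a triple that minimizes $C$. If there is none of finite cost, report that no cycle exists. Otherwise form the cycle from a shortest path $f\to s_1$ (trivial if $f=s_1$), the bottleneck path $s_1\to s_2$ with its edges expanded to shortest paths in $\mathcal P$ (the trivial path if $f\neq s_1=s_2$), and a shortest path $s_2\to f$ (trivial if $s_2=f$). 4. Compute a shortest path (possibly trivial) from an initial state to a vertex of the cycle. 5. Output the projection to $\mathcal T$ of the run that follows this path and then repeats the cycle forever. **Theorem (Correctness of Optimal-Run).** Step 1 can be carried out: there is an explicit translation that turns every LTL formula over $\Pi$ into a Büchi automaton with finitely many states accepting exactly the words that satisfy the formula. Suppose that $\mathcal T$ has at least one run satisfying $\phi=\varphi\wedge\mathbf G\mathbf F\,\pi$. Then Optimal-Run, with this translation or with any other automaton $\mathcal B$ as in step 1, outputs a run $r^*$ of $\mathcal T$ such that $r^*$ satisfies $\phi$ and $\mathcal C(r^*)\le\mathcal C(r)$ for every run $r$ of $\mathcal T$ satisfying $\phi$. -/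

import Mathlib

open Filter

/-! ## Linear temporal logic -/

/-- Formulas of linear temporal logic over the atomic propositions `AP`. -/
inductive LTL (AP : Type*) where
  | top : LTL AP
  | atom (a : AP) : LTL AP
  | or (φ ψ : LTL AP) : LTL AP
  | not (φ : LTL AP) : LTL AP
  | next (φ : LTL AP) : LTL AP
  | untl (φ ψ : LTL AP) : LTL AP

namespace LTL

variable {AP : Type*}

/-- Conjunction. -/
def and (φ ψ : LTL AP) : LTL AP := not (or (not φ) (not ψ))

/-- `F φ := ⊤ U φ`. -/
def eventually (φ : LTL AP) : LTL AP := untl top φ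

/-- `G φ := ¬ F ¬ φ`. -/
def always (φ : LTL AP) : LTL AP := not (eventually (not φ))

/-- The specification `ϕ ∧ G F π`. -/
def spec (ϕ : LTL AP) (π : AP) : LTL AP := and ϕ (always (eventually (atom π)))

/-- `SatAt ω i φ`: the suffix `ω_i ω_{i+1} …` of the infinite word `ω` over `2^AP` satisfies
`φ`. -/
def SatAt (ω : ℕ → Finset AP) : ℕ → LTL AP → Prop
  | _, top => True
  | i, atom a => a ∈ ω i
  | i, or φ ψ => SatAt ω i φ ∨ SatAt ω i ψ
  | i, not φ => ¬ SatAt ω i φ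
  | i, next φ => SatAt ω (i + 1) φ
  | i, untl φ ψ => ∃ j, i ≤ j ∧ SatAt ω j ψ ∧ ∀ k, i ≤ k → k < j → SatAt ω k φ

/-- The infinite word `ω` satisfies `φ`. -/
def Sat (ω : ℕ → Finset AP) (φ : LTL AP) : Prop := SatAt ω 0 φ

end LTL

/-! ## Weighted transition systems, runs and the cost of a run -/

/-- A weighted transition system with states `Q`, propositions `AP` and weights in `K`; it is
non-blocking. Only the values of `w` on the transitions `R` matter. -/
structure WTS (Q AP K : Type*) [Zero K] [LT K] where
  q₀ : Q
  R : Finset (Q × Q)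
  L : Q → Finset AP
  w : Q → Q → K
  w_pos : ∀ p q, (p, q) ∈ R → 0 < w p q
  nonblocking : ∀ p, ∃ q, (p, q) ∈ R

namespace WTS

variable {Q AP : Type*}

/-- `r` is a run: it starts in `q₀` and follows the transitions. -/
def IsRun {K : Type*} [Zero K] [LT K] (T : WTS Q AP K) (r : ℕ → Q) : Prop :=
  r 0 = T.q₀ ∧ ∀ i, (r i, r (i + 1)) ∈ T.R

/-- The word produced by a sequence of states. -/
def word {K : Type*} [Zero K] [LT K] (T : WTS Q AP K) (r : ℕ → Q) : ℕ → Finset AP :=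
  fun i => T.L (r i)

/-- `r` is a run whose word satisfies `φ`. -/
def IsSatisfyingRun {K : Type*} [Zero K] [LT K] (T : WTS Q AP K) (φ : LTL AP) (r : ℕ → Q) :
    Prop :=
  T.IsRun r ∧ LTL.Sat (T.word r) φ

/-- The time `t_i` at which the `i`-th state is reached; `t_0 = 0`. -/
noncomputable def time (T : WTS Q AP ℝ) (r : ℕ → Q) (i : ℕ) : ℝ :=
  ∑ j ∈ Finset.range i, T.w (r j) (r (j + 1))

/-- The `i`-th time instance (counted from `0`) at which `π` holds. It is meaningful when `π` holds
infinitely often, in particular on every run that satisfies `ϕ ∧ G F π`. -/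
noncomputable def propTime (T : WTS Q AP ℝ) (π : AP) (r : ℕ → Q) (i : ℕ) : ℝ :=
  T.time r (Nat.nth (fun n => π ∈ T.L (r n)) i)

/-- The cost: the limit superior, possibly `+∞`, of the times between successive occurrences
of `π`. -/
noncomputable def cost (T : WTS Q AP ℝ) (π : AP) (r : ℕ → Q) : EReal :=
  limsup (fun i => ((T.propTime π r (i + 1) - T.propTime π r i : ℝ) : EReal)) atTop

end WTS

/-! ## Büchi automata and the translation of formulas -/

/-- A Büchi automaton with states `S` and alphabet `A`. -/
structure BuchiAutomaton (S A : Type*) where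
  init : Finset S
  δ : Finset (S × A × S)
  acc : Finset S

namespace BuchiAutomaton

/-- `ρ` is a run over the word `ω`. -/
def IsRunOver {S A : Type*} (B : BuchiAutomaton S A) (ω : ℕ → A) (ρ : ℕ → S) : Prop :=
  ρ 0 ∈ B.init ∧ ∀ i, (ρ i, ω i, ρ (i + 1)) ∈ B.δ

/-- `ω` is accepted: some run over `ω` visits some accepting state infinitely often. -/
def Accepts {S A : Type*} (B : BuchiAutomaton S A) (ω : ℕ → A) : Prop :=
  ∃ ρ, B.IsRunOver ω ρ ∧ ∃ f ∈ B.acc, ∃ᶠ i in atTop, ρ i = f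

/-- The automaton accepts exactly the infinite words that satisfy `φ`. -/
def Recognizes {S AP : Type*} (B : BuchiAutomaton S (Finset AP)) (φ : LTL AP) : Prop :=
  ∀ ω : ℕ → Finset AP, B.Accepts ω ↔ LTL.Sat ω φ

end BuchiAutomaton

namespace LTL

variable {AP : Type*}

/-- Guesses, at one position of a word, of the truth values of the atoms, `X`-formulas and
`U`-formulas that occur in the given formula. -/
def Guess : LTL AP → Type
  | top => Unit
  | atom _ => Bool
  | or φ ψ => Guess φ × Guess ψ
  | not φ => Guess φ
  | next φ => Bool × Guess φ
  | untl φ ψ => Bool × Guess φ × Guess ψ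

instance boolFinEnum : FinEnum Bool := FinEnum.ofList [false, true] (by decide)

/-- The guesses form an explicitly enumerated finite type. -/
instance guessFinEnum : (φ : LTL AP) → FinEnum (Guess φ)
  | top => (inferInstance : FinEnum Unit)
  | atom _ => boolFinEnum
  | or φ ψ => @FinEnum.prod _ _ (guessFinEnum φ) (guessFinEnum ψ)
  | not φ => guessFinEnum φ
  | next φ => @FinEnum.prod _ _ boolFinEnum (guessFinEnum φ)
  | untl φ ψ => @FinEnum.prod _ _ boolFinEnum
      (@FinEnum.prod _ _ (guessFinEnum φ) (guessFinEnum ψ))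

/-- The truth value of the whole formula under a guess. -/
def value : (φ : LTL AP) → Guess φ → Bool
  | top, _ => true
  | atom _, b => b
  | or φ ψ, g => value φ g.1 || value ψ g.2
  | not φ, g => !(value φ g)
  | next _, g => g.1
  | untl _ _, g => g.1

/-- `step φ g a g'`: the guess `g` is correct on the letter `a`, and consistent with the guess `g'`
at the next position, up to the postponement of `U`-formulas forever. -/
def step [DecidableEq AP] : (φ : LTL AP) → Guess φ → Finset AP → Guess φ → Bool
  | top, _, _, _ => true
  | atom p, b, a, _ => b == decide (p ∈ a)
  | or φ ψ, g, a, g' => step φ g.1 a g'.1 && step ψ g.2 a g'.2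
  | not φ, g, a, g' => step φ g a g'
  | next φ, g, a, g' => (g.1 == value φ g'.2) && step φ g.2 a g'.2
  | untl φ ψ, g, a, g' =>
      (g.1 == (value ψ g.2.2 || (value φ g.2.1 && g'.1))) &&
        (step φ g.2.1 a g'.2.1 && step ψ g.2.2 a g'.2.2)

/-- The fairness conditions, each of which has to hold infinitely often: for every subformula
`φ U ψ`, it is false or `ψ` is true. -/
def fairness : (φ : LTL AP) → List (Guess φ → Bool)
  | top => []
  | atom _ => []
  | or φ ψ => (fairness φ).map (fun c (g : Guess φ × Guess ψ) => c g.1) ++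
      (fairness ψ).map (fun c (g : Guess φ × Guess ψ) => c g.2)
  | not φ => fairness φ
  | next φ => (fairness φ).map (fun c (g : Bool × Guess φ) => c g.2)
  | untl φ ψ => (fun (g : Bool × Guess φ × Guess ψ) => !g.1 || value ψ g.2.2) ::
      ((fairness φ).map (fun c (g : Bool × Guess φ × Guess ψ) => c g.2.1) ++
        (fairness ψ).map (fun c (g : Bool × Guess φ × Guess ψ) => c g.2.2))

/-- States of the automaton for `φ`: a guess, and a counter for the fairness condition that is
waited for. -/
abbrev BuchiState (φ : LTL AP) : Type := Guess φ × Fin ((fairness φ).length + 1)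

/-- The counter advances when the current condition holds; after the last condition it is reset. -/
def nextCounter (φ : LTL AP) (g : Guess φ) (c : Fin ((fairness φ).length + 1)) :
    Fin ((fairness φ).length + 1) :=
  if h : c.val < (fairness φ).length then
    if (fairness φ)[c.val] g then ⟨c.val + 1, Nat.succ_lt_succ h⟩ else c
  else 0

/-- The translation of a formula into a Büchi automaton with alphabet `2^AP`. -/
def toBuchi [Fintype AP] [DecidableEq AP] (φ : LTL AP) :
    BuchiAutomaton (BuchiState φ) (Finset AP) where
  init := Finset.univ.filter fun s => value φ s.1 = true ∧ s.2 = 0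
  δ := Finset.univ.filter fun e =>
    step φ e.1.1 e.2.1 e.2.2.1 = true ∧ e.2.2.2 = nextCounter φ e.1.1 e.1.2
  acc := Finset.univ.filter fun s => s.2 = Fin.last _

end LTL

/-! ## The product automaton -/

/-- A product automaton: an automaton without alphabet, with weighted transitions and a
distinguished set of states. -/
structure ProductAutomaton (V K : Type*) where
  init : V → Bool
  trans : V → V → Bool
  acc : V → Bool
  w : V → V → K
  prop : V → Bool

/-- The product of a transition system and a Büchi automaton; `prop` marks the states in which `π`
holds. -/
def productAutomaton {Q AP S K : Type*} [Zero K] [LT K] [DecidableEq AP] [DecidableEq Q]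
    [DecidableEq S] (T : WTS Q AP K) (π : AP) (B : BuchiAutomaton S (Finset AP)) :
    ProductAutomaton (Q × S) K where
  init p := decide (p.1 = T.q₀ ∧ p.2 ∈ B.init)
  trans p p' := decide ((p.1, p'.1) ∈ T.R ∧ (p.2, T.L p.1, p'.2) ∈ B.δ)
  acc p := decide (p.2 ∈ B.acc)
  w p p' := T.w p.1 p'.1
  prop p := decide (π ∈ T.L p.1)

/-- The product automaton as a weighted graph, given by its matrix of edge weights; `⊤` means that
there is no edge. -/
def ProductAutomaton.graph {V K : Type*} (P : ProductAutomaton V K) : V → V → WithTop K :=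
  fun u v => if P.trans u v then (P.w u v : WithTop K) else ⊤

/-! ## Graph algorithms

A graph on `V` is the matrix of its edge weights, with `⊤` for a missing edge. All procedures are
executable whenever the arithmetic and the order of `K` are. -/

section GraphAlgorithms

variable {V K : Type*} [FinEnum V] [LinearOrder K]

/-- The main loop of Dijkstra's algorithm. `U` holds the vertices that are not settled, and `l v`
the tentative distance and predecessor of `v`; `op d e` is the length of a path of length `d`
extended by an edge of length `e`. Every round settles a vertex with least tentative distance and
relaxes its outgoing edges. -/
def dijkstraLoop (op : WithTop K → WithTop K → WithTop K) (A : V → V → WithTop K) :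
    ℕ → List V → (V → WithTop K × V) → (V → WithTop K × V)
  | 0, _, l => l
  | n + 1, U, l =>
    match U.argmin (fun v => (l v).1) with
    | none => l
    | some v =>
      let d := (l v).1
      let U' := U.erase v
      dijkstraLoop op A n U' fun u =>
        if u ∈ U' ∧ op d (A v u) < (l u).1 then (op d (A v u), v) else l u

/-- Dijkstra's algorithm from the source `a`: the distance from `a` and the predecessor on an
optimal path from `a`, for every vertex. Paths have at least one edge, so that the entry of `a`
itself concerns the cycles through `a`. The predecessor is meaningful only at finite distance. -/
def dijkstra (op : WithTop K → WithTop K → WithTop K) (A : V → V → WithTop K) (a : V) :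
    V → WithTop K × V :=
  dijkstraLoop op A (FinEnum.card V) (FinEnum.toList V) fun v => (A a v, a)

/-- Shortest paths: minimize the sum of the edge lengths. -/
def shortestPath [Add K] (A : V → V → WithTop K) : V → V → WithTop K × V :=
  dijkstra (· + ·) A

/-- Shortest bottleneck paths: minimize the maximum edge length. -/
def shortestBotPath (A : V → V → WithTop K) : V → V → WithTop K × V :=
  dijkstra max A

/-- The path from `a` to `v` given by the predecessors `P`, as the list of its vertices without the
last vertex `v`; the first argument bounds the number of edges. -/
def tracePath (P : V → V) (a : V) : ℕ → V → List V
  | 0, _ => []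
  | n + 1, v => if P v = a then [a] else tracePath P a n (P v) ++ [P v]

/-- The vertices of a path from `a` to `v` with labels `l` as computed by `dijkstra` from the
source `a`, without the last vertex `v`. -/
def extractPath (l : V → WithTop K × V) (a v : V) : List V :=
  tracePath (fun u => (l u).2) a (FinEnum.card V) v

/-- The distance from `a` to `v`, where the trivial path from a vertex to itself is allowed. -/
def dist₀ [AddZeroClass K] (A : V → V → WithTop K) (a v : V) : WithTop K :=
  if a = v then 0 else (shortestPath A a v).1

/-- A shortest path from `a` to `v`, without its last vertex `v`, where the trivial path from a
vertex to itself is allowed. -/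
def path₀ [AddZeroClass K] (A : V → V → WithTop K) (a v : V) : List V :=
  if a = v then [] else extractPath (shortestPath A a) a v

/-- The graph `G_S` with vertices `S`, whose edge lengths are the shortest-path distances. -/
def graphOn [Add K] (A : V → V → WithTop K) (S : V → Bool) : V → V → WithTop K :=
  fun s t => if S s && S t then (shortestPath A s t).1 else ⊤

/-- The cost `C(f, s₁, s₂)` of a triple. -/
def tripleCost [AddZeroClass K] (A : V → V → WithTop K) (S : V → Bool) (x : V × V × V) :
    WithTop K :=
  let f := x.1
  let s₁ := x.2.1
  let s₂ := x.2.2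
  let c := dist₀ A f s₁ + dist₀ A s₂ f
  if f ≠ s₁ ∧ s₁ = s₂ then c else max c (shortestBotPath (graphOn A S) s₁ s₂).1

/-- The shortest bottleneck path from `s` to `t` in `G_S`, without its last vertex `t`, with every
edge replaced by a shortest path in the original graph. -/
def bottleneckPath [Add K] (A : V → V → WithTop K) (S : V → Bool) (s t : V) : List V :=
  let b := extractPath (shortestBotPath (graphOn A S) s) s t
  (b.zip (b.tail ++ [t])).flatMap fun e => extractPath (shortestPath A e.1) e.1 e.2

/-- The cycle of a triple, without the repetition of its first vertex: a shortest path from `f` to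
`s₁`, a bottleneck path from `s₁` to `s₂` (the trivial one if `f ≠ s₁ = s₂`), and a shortest path
from `s₂` to `f`. -/
def tripleCycle [AddZeroClass K] (A : V → V → WithTop K) (S : V → Bool) (x : V × V × V) :
    List V :=
  let f := x.1
  let s₁ := x.2.1
  let s₂ := x.2.2
  path₀ A f s₁ ++ (if f ≠ s₁ ∧ s₁ = s₂ then [] else bottleneckPath A S s₁ s₂) ++ path₀ A s₂ f

/-- Min-Bottleneck-Cycle: a cycle through a vertex of `F` with least `S`-bottleneck length, as the
list of its vertices without repetition of the first, or `none` if there is no such cycle. -/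
def minBottleneckCycle [AddZeroClass K] (A : V → V → WithTop K) (S F : V → Bool) :
    Option (List V) :=
  let triples := ((FinEnum.toList V).filter F).product
    (((FinEnum.toList V).filter S).product ((FinEnum.toList V).filter S))
  match triples.argmin (tripleCost A S) with
  | none => none
  | some x => if tripleCost A S x = ⊤ then none else some (tripleCycle A S x)

end GraphAlgorithms

/-! ## The algorithm Optimal-Run -/

/-- Optimal-Run on the level of the product automaton: a prefix and a cycle, as lists of states; the
corresponding run follows the prefix and then repeats the cycle forever. The cycle passes through an
accepting state that is reachable from an initial state, and the prefix is a shortest path from an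
initial state to the cycle, without its last vertex; the cycle is listed from that vertex on. -/
def optimalProductRun {V K : Type*} [FinEnum V] [LinearOrder K] [AddZeroClass K]
    (P : ProductAutomaton V K) : Option (List V × List V) :=
  let A := P.graph
  let inits := (FinEnum.toList V).filter P.init
  let F : V → Bool := fun f => P.acc f && inits.any fun i => decide (dist₀ A i f ≠ ⊤)
  match minBottleneckCycle A P.prop F with
  | none => none
  | some c =>
    match (inits.product c).argmin (fun x => dist₀ A x.1 x.2) with
    | none => none
    | some x => some (path₀ A x.1 x.2, c.rotate (c.idxOf x.2))

/-- Optimal-Run, where the Büchi automaton `B` is the result of the translation of the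
specification: the run of the product, projected to the transition system. -/
def optimalRunOf {Q AP S K : Type*} [FinEnum Q] [DecidableEq AP] [FinEnum S] [LinearOrder K]
    [AddZeroClass K] (T : WTS Q AP K) (π : AP) (B : BuchiAutomaton S (Finset AP)) :
    Option (List Q × List Q) :=
  (optimalProductRun (productAutomaton T π B)).map fun x => (x.1.map Prod.fst, x.2.map Prod.fst)

/-- Optimal-Run, with the translation `LTL.toBuchi`. -/
def optimalRun {Q AP K : Type*} [FinEnum Q] [Fintype AP] [DecidableEq AP] [LinearOrder K]
    [AddZeroClass K] (T : WTS Q AP K) (ϕ : LTL AP) (π : AP) : Option (List Q × List Q) :=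
  optimalRunOf T π (LTL.spec ϕ π).toBuchi

/-- The infinite sequence `pre · cyc · cyc · cyc ⋯` (the default value `d` only matters for an empty
cycle). -/
def lasso {Q : Type*} (d : Q) (pre cyc : List Q) (n : ℕ) : Q :=
  if n < pre.length then pre.getD n d else cyc.getD ((n - pre.length) % cyc.length) d

/-- The output `o` of the algorithm describes a run that satisfies `ϕ ∧ G F π` and has least cost
among all such runs. -/
def IsSolution {Q AP : Type*} (T : WTS Q AP ℝ) (ϕ : LTL AP) (π : AP)
    (o : Option (List Q × List Q)) : Prop :=
  ∃ pre cyc, o = some (pre, cyc) ∧ cyc ≠ [] ∧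
    T.IsSatisfyingRun (LTL.spec ϕ π) (lasso T.q₀ pre cyc) ∧
    ∀ r, T.IsSatisfyingRun (LTL.spec ϕ π) r → T.cost π (lasso T.q₀ pre cyc) ≤ T.cost π r

/-!
The proof has three ingredients.

*Translation.* A locally consistent sequence of guesses of truth values is correct as soon as no
`U`-formula is postponed forever, which is what the fairness conditions say
(`LTL.value_iff_satAt`); conversely the actual truth values form such a sequence. The counter of
`LTL.toBuchi` reaches its last value infinitely often iff every fairness condition holds infinitely
often.

*Dijkstra's algorithm.* Sums and maxima are treated together: all that is needed of the operation
is that it does not decrease lengths. The loop invariant `DijkstraInvariant` yields that the labels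
are at most the lengths of the edges from the source, that no edge can be relaxed any more, and that
tracing predecessors gives a path whose length is the label (`opPath_dijkstra`). The first two facts
bound the labels by the lengths of arbitrary walks.

*Costs.* Let `C` be the least cost of a triple. The cycle of an optimal triple is, up to rotation,
composed of segments of length at most `C` that end in states with `π` (`sWalk_tripleCycle`), so on
the run that repeats it every gap between occurrences of `π` is eventually at most `C`
(`SWalk.lasso`). Conversely, a satisfying run lifts to a run of the product that visits some
accepting state `f` infinitely often. If its gaps were eventually less than `C`, then two visits of
`f` that agree in the states with `π` just before and just after them would give a triple of cost
less than `C` (`exists_tripleCost_lt`). The same argument with `⊤` in place of `C` shows that some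
triple has finite cost, so that the algorithm does return a run.
-/

/-- A property of natural numbers that is frequently witnessed by an element of a finite type is
frequently witnessed by a fixed element. -/
theorem exists_frequently_of_frequently_exists {ι : Type*} [Finite ι] {p : ℕ → ι → Prop}
    (h : ∃ᶠ n in atTop, ∃ i, p n i) : ∃ i, ∃ᶠ n in atTop, p n i := by
  by_contra hcon
  simp only [not_exists, not_frequently] at hcon
  exact h ((eventually_all.2 hcon).mono fun n hn ⟨i, hi⟩ => hn i hi)

/-! ### The translation of formulas into Büchi automata -/

namespace LTL

variable {AP : Type*}

theorem sat_spec_iff (ω : ℕ → Finset AP) (ϕ : LTL AP) (π : AP) :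
    Sat ω (spec ϕ π) ↔ Sat ω ϕ ∧ ∃ᶠ i in atTop, π ∈ ω i := by
  simp [Sat, spec, LTL.and, always, eventually, SatAt, frequently_atTop]

/-- A sequence of guesses that is locally consistent and satisfies all fairness conditions
infinitely often consists of the actual truth values. For `φ U ψ`, consistency alone would allow
the guess to be true with `ψ` postponed forever; the fairness condition excludes this. -/
theorem value_iff_satAt [DecidableEq AP] (ω : ℕ → Finset AP) (φ : LTL AP) (g : ℕ → Guess φ)
    (hstep : ∀ i, step φ (g i) (ω i) (g (i + 1)) = true)
    (hfair : ∀ c ∈ fairness φ, ∃ᶠ i in atTop, c (g i) = true) (i : ℕ) :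
    value φ (g i) = true ↔ SatAt ω i φ := by
  induction φ generalizing i with
  | top => simp [value, SatAt]
  | atom a =>
    have h : (value (atom a) (g i) == decide (a ∈ ω i)) = true := hstep i
    rw [beq_iff_eq.1 h, decide_eq_true_eq, SatAt]
  | or φ ψ ihφ ihψ =>
    simp only [step, Bool.and_eq_true] at hstep
    have h1 := ihφ (fun i => (g i).1) (fun i => (hstep i).1)
      (fun c hc => hfair (fun x : Guess φ × Guess ψ => c x.1)
        (List.mem_append_left _ (List.mem_map.2 ⟨c, hc, rfl⟩))) i
    have h2 := ihψ (fun i => (g i).2) (fun i => (hstep i).2)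
      (fun c hc => hfair (fun x : Guess φ × Guess ψ => c x.2)
        (List.mem_append_right _ (List.mem_map.2 ⟨c, hc, rfl⟩))) i
    simp only [value, SatAt, Bool.or_eq_true, ← h1, ← h2]
  | not φ ih =>
    have h := ih g hstep hfair i
    simp only [value, SatAt, ← h]
    simp
  | next φ ih =>
    simp only [step, Bool.and_eq_true, beq_iff_eq] at hstep
    have h := ih (fun i => (g i).2) (fun i => (hstep i).2)
      (fun c hc => hfair (fun x : Bool × Guess φ => c x.2) (List.mem_map.2 ⟨c, hc, rfl⟩)) (i + 1)
    simp only [value, SatAt, ← h, (hstep i).1]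
  | untl φ ψ ihφ ihψ =>
    simp only [step, Bool.and_eq_true, beq_iff_eq] at hstep
    have h1 := ihφ (fun i => (g i).2.1) (fun i => (hstep i).2.1)
      (fun c hc => hfair (fun x : Bool × Guess φ × Guess ψ => c x.2.1)
        (List.mem_cons_of_mem _ (List.mem_append_left _ (List.mem_map.2 ⟨c, hc, rfl⟩))))
    have h2 := ihψ (fun i => (g i).2.2) (fun i => (hstep i).2.2)
      (fun c hc => hfair (fun x : Bool × Guess φ × Guess ψ => c x.2.2)
        (List.mem_cons_of_mem _ (List.mem_append_right _ (List.mem_map.2 ⟨c, hc, rfl⟩))))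
    have h3 : ∀ i, (g i).1 = true ↔
        SatAt ω i ψ ∨ (SatAt ω i φ ∧ (g (i + 1)).1 = true) := by
      intro i
      rw [← h1, ← h2, (hstep i).1]
      simp
    have h4 := frequently_atTop.1 (hfair _ List.mem_cons_self)
    simp only [value, SatAt]
    constructor
    · intro hi
      by_contra hcon
      push Not at hcon
      have key : ∀ k, (g (i + k)).1 = true ∧ ∀ l, i ≤ l → l < i + k → SatAt ω l φ := by
        intro k
        induction k with
        | zero => exact ⟨hi, fun l h h' => by omega⟩
        | succ k ih =>
          have hn : ¬ SatAt ω (i + k) ψ := fun h => by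
            obtain ⟨l, hl, hl', hl''⟩ := hcon (i + k) (by omega) h
            exact hl'' (ih.2 l hl hl')
          have h5 := ((h3 (i + k)).1 ih.1).resolve_left hn
          refine ⟨h5.2, fun l hl hl' => ?_⟩
          rcases Nat.lt_or_ge l (i + k) with h | h
          · exact ih.2 l hl h
          · obtain rfl : l = i + k := by omega
            exact h5.1
      obtain ⟨j, hj, hj'⟩ := h4 i
      obtain ⟨k, rfl⟩ := Nat.exists_eq_add_of_le hj
      have h6 : value ψ (g (i + k)).2.2 = true := by simpa [(key k).1] using hj'
      obtain ⟨l, hl, hl', hl''⟩ := hcon (i + k) hj ((h2 _).1 h6)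
      exact hl'' ((key k).2 l hl hl')
    · rintro ⟨j, hij, hj, hk⟩
      have key : ∀ d l, l + d = j → i ≤ l → (g l).1 = true := by
        intro d
        induction d with
        | zero => rintro l rfl _; exact (h3 l).2 (Or.inl hj)
        | succ d ih =>
          intro l hl hil
          exact (h3 l).2 (Or.inr ⟨hk l hil (by omega), ih (l + 1) (by omega) (by omega)⟩)
      exact key (j - i) i (by omega) le_rfl

open Classical in
/-- The guess consisting of the actual truth values at position `i` of the word `ω`. -/
noncomputable def truth (ω : ℕ → Finset AP) (i : ℕ) : (φ : LTL AP) → Guess φ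
  | top => ()
  | atom a => decide (a ∈ ω i)
  | or φ ψ => (truth ω i φ, truth ω i ψ)
  | not φ => truth ω i φ
  | next φ => (decide (SatAt ω (i + 1) φ), truth ω i φ)
  | untl φ ψ => (decide (SatAt ω i (untl φ ψ)), truth ω i φ, truth ω i ψ)

theorem value_truth (ω : ℕ → Finset AP) (i : ℕ) (φ : LTL AP) :
    value φ (truth ω i φ) = true ↔ SatAt ω i φ := by
  induction φ with
  | top => simp [value, SatAt]
  | atom a => simp [value, truth, SatAt]
  | or φ ψ ihφ ihψ => simp [value, truth, SatAt, ihφ, ihψ]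
  | not φ ih => simp [value, truth, SatAt, ← ih]
  | next φ ih => simp [value, truth, SatAt]
  | untl φ ψ ihφ ihψ => simp [value, truth]

/-- The expansion law of the operator `U`. -/
theorem satAt_untl_iff (ω : ℕ → Finset AP) (i : ℕ) (φ ψ : LTL AP) :
    SatAt ω i (untl φ ψ) ↔
      SatAt ω i ψ ∨ (SatAt ω i φ ∧ SatAt ω (i + 1) (untl φ ψ)) := by
  simp only [SatAt]
  constructor
  · rintro ⟨j, hij, hj, hk⟩
    rcases hij.eq_or_lt with rfl | h
    · exact Or.inl hj
    · exact Or.inr ⟨hk i le_rfl h, j, h, hj, fun k h1 h2 => hk k (by omega) h2⟩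
  · rintro (h | ⟨h, j, hij, hj, hk⟩)
    · exact ⟨i, le_rfl, h, fun k h1 h2 => by omega⟩
    · refine ⟨j, by omega, hj, fun k h1 h2 => ?_⟩
      rcases h1.eq_or_lt with rfl | h3
      · exact h
      · exact hk k h3 h2

theorem step_truth [DecidableEq AP] (ω : ℕ → Finset AP) (i : ℕ) (φ : LTL AP) :
    step φ (truth ω i φ) (ω i) (truth ω (i + 1) φ) = true := by
  classical
  induction φ with
  | top => rfl
  | atom a =>
    have h (d₁ d₂ : Decidable (a ∈ ω i)) :
        (@decide (a ∈ ω i) d₁ == @decide (a ∈ ω i) d₂) = true := by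
      rw [beq_iff_eq, decide_eq_decide]
    exact h _ _
  | or φ ψ ihφ ihψ => simp [step, truth, ihφ, ihψ]
  | not φ ih => simpa [step, truth] using ih
  | next φ ih =>
    simp only [step, truth, ih, Bool.and_true, beq_iff_eq]
    rw [Bool.eq_iff_iff, value_truth, decide_eq_true_eq]
  | untl φ ψ ihφ ihψ =>
    simp only [step, truth, ihφ, ihψ, Bool.and_true, beq_iff_eq]
    rw [Bool.eq_iff_iff, Bool.or_eq_true, Bool.and_eq_true, value_truth, value_truth,
      decide_eq_true_eq, decide_eq_true_eq]
    exact satAt_untl_iff ω i φ ψ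

theorem fairness_truth (ω : ℕ → Finset AP) (φ : LTL AP) :
    ∀ c ∈ fairness φ, ∃ᶠ i in atTop, c (truth ω i φ) = true := by
  induction φ with
  | top => simp [fairness]
  | atom a => simp [fairness]
  | or φ ψ ihφ ihψ =>
    intro c h
    rcases List.mem_append.1 h with h | h <;> obtain ⟨c, hc, rfl⟩ := List.mem_map.1 h
    exacts [ihφ c hc, ihψ c hc]
  | not φ ih => exact ih
  | next φ ih =>
    intro c h
    obtain ⟨c, hc, rfl⟩ := List.mem_map.1 h
    exact ih c hc
  | untl φ ψ ihφ ihψ =>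
    intro c h
    rcases List.mem_cons.1 h with rfl | h
    · rw [frequently_atTop]
      intro N
      by_cases h : SatAt ω N (untl φ ψ)
      · obtain ⟨j, hj, hψ, -⟩ := id h
        exact ⟨j, hj, by simp [truth, value_truth, hψ]⟩
      · exact ⟨N, le_rfl, by simp [truth, h]⟩
    · rcases List.mem_append.1 h with h | h <;> obtain ⟨c, hc, rfl⟩ := List.mem_map.1 h
      exacts [ihφ c hc, ihψ c hc]

/-- If the counter reaches its last value infinitely often, then every fairness condition holds
infinitely often: between two such moments the counter starts from `0` and has to pass every
intermediate value. -/
theorem frequently_fairness_of_counter (φ : LTL AP) (g : ℕ → Guess φ)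
    (c : ℕ → Fin ((fairness φ).length + 1)) (hc : ∀ i, c (i + 1) = nextCounter φ (g i) (c i))
    (hlast : ∃ᶠ i in atTop, c i = Fin.last _) :
    ∀ f ∈ fairness φ, ∃ᶠ i in atTop, f (g i) = true := by
  intro f hf
  obtain ⟨k, hk, rfl⟩ := List.mem_iff_getElem.1 hf
  rw [frequently_atTop] at hlast ⊢
  intro N
  obtain ⟨i, hi, hi'⟩ := hlast N
  obtain ⟨j, hj, hj'⟩ := hlast (i + 1)
  have h0 : (c (i + 1)).val = 0 := by simp [hc, nextCounter, hi']
  have hex : ∃ d, k < (c (i + 1 + d)).val := ⟨j - (i + 1), by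
    rw [Nat.add_sub_cancel' hj, hj']; simpa using hk⟩
  classical
  obtain ⟨d, hd⟩ : ∃ d, Nat.find hex = d + 1 := by
    refine Nat.exists_eq_succ_of_ne_zero fun h => ?_
    have := Nat.find_spec hex
    rw [h] at this
    simp [h0] at this
  have h1 : k < (c (i + 1 + d + 1)).val := by
    have := Nat.find_spec hex
    rwa [hd] at this
  have h2 : (c (i + 1 + d)).val ≤ k := not_lt.1 (Nat.find_min hex (by omega))
  refine ⟨i + 1 + d, by omega, ?_⟩
  rw [hc] at h1
  unfold nextCounter at h1
  split_ifs at h1 with h3 h4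
  · obtain h5 : (c (i + 1 + d)).val = k := by simp only at h1; omega
    subst h5
    exact h4
  · omega
  · simp at h1

/-- If every fairness condition holds infinitely often, then the counter reaches its last value
infinitely often. -/
theorem frequently_counter_of_fairness (φ : LTL AP) (g : ℕ → Guess φ)
    (c : ℕ → Fin ((fairness φ).length + 1)) (hc : ∀ i, c (i + 1) = nextCounter φ (g i) (c i))
    (hfair : ∀ f ∈ fairness φ, ∃ᶠ i in atTop, f (g i) = true) :
    ∃ᶠ i in atTop, c i = Fin.last _ := by
  rw [frequently_atTop]
  intro N
  have key : ∀ d i, (c i).val + d = (fairness φ).length → ∃ j ≥ i, c j = Fin.last _ := by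
    intro d
    induction d with
    | zero => exact fun i hi => ⟨i, le_rfl, Fin.ext (by simpa using hi)⟩
    | succ d ih =>
      intro i hi
      have hk : (c i).val < (fairness φ).length := by omega
      obtain ⟨j, hj, hj'⟩ := frequently_atTop.1 (hfair _ (List.getElem_mem hk)) i
      obtain ⟨e, rfl⟩ := Nat.exists_eq_add_of_le hj
      classical
      have hex : ∃ e, (fairness φ)[(c i).val] (g (i + e)) = true := ⟨e, hj'⟩
      have hstay : ∀ e ≤ Nat.find hex, c (i + e) = c i := by
        intro e
        induction e with
        | zero => simp
        | succ e ihe =>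
          intro he
          have h1 := Nat.find_min hex (m := e) (by omega)
          rw [← Nat.add_assoc, hc, ihe (by omega)]
          simp [nextCounter, hk, h1]
      have h2 : (c (i + Nat.find hex + 1)).val = (c i).val + 1 := by
        rw [hc, hstay _ le_rfl]
        simp [nextCounter, hk, Nat.find_spec hex]
      obtain ⟨j, hj, hj'⟩ := ih (i + Nat.find hex + 1) (by omega)
      exact ⟨j, by omega, hj'⟩
  exact key ((fairness φ).length - (c N).val) N (by have := (c N).isLt; omega)

/-- The translation of formulas into Büchi automata is correct. -/
theorem toBuchi_recognizes [Fintype AP] [DecidableEq AP] (φ : LTL AP) :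
    φ.toBuchi.Recognizes φ := by
  intro ω
  constructor
  · rintro ⟨ρ, ⟨h0, hρ⟩, f, hf, hfreq⟩
    simp only [toBuchi, Finset.mem_filter, Finset.mem_univ, true_and] at h0 hρ hf
    have hfair := frequently_fairness_of_counter φ (fun i => (ρ i).1) (fun i => (ρ i).2)
      (fun i => (hρ i).2) (hfreq.mono fun i hi => by rw [hi, hf])
    exact (value_iff_satAt ω φ (fun i => (ρ i).1) (fun i => (hρ i).1) hfair 0).1 h0.1
  · intro hsat
    let c : ℕ → Fin ((fairness φ).length + 1) :=
      fun i => Nat.rec 0 (fun i x => nextCounter φ (truth ω i φ) x) i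
    have hlast := frequently_counter_of_fairness φ (fun i => truth ω i φ) c (fun i => rfl)
      (fairness_truth ω φ)
    -- One of the finitely many accepting states is visited infinitely often.
    obtain ⟨s, hs⟩ := exists_frequently_of_frequently_exists
      (p := fun i (s : BuchiState φ) => c i = Fin.last _ ∧ (truth ω i φ, c i) = s)
      (hlast.mono fun i hi => ⟨_, hi, rfl⟩)
    refine ⟨fun i => (truth ω i φ, c i), ⟨?_, fun i => ?_⟩, s, ?_, hs.mono fun i hi => hi.2⟩
    · simp only [toBuchi, Finset.mem_filter, Finset.mem_univ, true_and]
      exact ⟨(value_truth ω 0 φ).2 hsat, rfl⟩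
    · simp only [toBuchi, Finset.mem_filter, Finset.mem_univ, true_and]
      exact ⟨step_truth ω i φ, rfl⟩
    · obtain ⟨i, hi, rfl⟩ := hs.exists
      simpa [toBuchi] using hi

end LTL

/-! ### Dijkstra's algorithm -/

section Dijkstra

variable {V K : Type*}

/-- A path with at least one edge from `a`, its vertices without the last one, its last vertex, and
its length with respect to `op`. -/
inductive OpPath (op : WithTop K → WithTop K → WithTop K) (A : V → V → WithTop K)
    (a : V) : List V → V → WithTop K → Prop
  | single (v : V) : OpPath op A a [a] v (A a v)
  | snoc {p : List V} {u : V} {d : WithTop K} (v : V) (h : OpPath op A a p u d) :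
      OpPath op A a (p ++ [u]) v (op d (A u v))

theorem OpPath.ne_nil {op : WithTop K → WithTop K → WithTop K} {A : V → V → WithTop K} {a v : V}
    {p : List V} {d : WithTop K} (h : OpPath op A a p v d) : p ≠ [] := by
  cases h <;> simp

variable [FinEnum V] [LinearOrder K]

/-- The invariant of the main loop of Dijkstra's algorithm with source `a`, where the vertices in
`U` are not settled. The function `rank` numbers the settled vertices in the order in which they
were settled; it decreases along predecessors, so that tracing predecessors ends in `a`. The
constant `z` is a lower bound of all edge lengths. -/
structure DijkstraInvariant (op : WithTop K → WithTop K → WithTop K) (A : V → V → WithTop K)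
    (z : WithTop K) (a : V) (U : List V) (l : V → WithTop K × V) (rank : V → ℕ) : Prop where
  nodup : U.Nodup
  length_le : U.length ≤ FinEnum.card V
  le_label : ∀ v, z ≤ (l v).1
  settled_le : ∀ u, u ∉ U → ∀ v ∈ U, (l u).1 ≤ (l v).1
  relaxed : ∀ u, u ∉ U → ∀ v, (l v).1 ≤ op (l u).1 (A u v)
  le_edge : ∀ v, (l v).1 ≤ A a v
  rank_lt : ∀ u, u ∉ U → rank u + U.length < FinEnum.card V
  pred : ∀ v, l v = (A a v, a) ∨
    ((l v).2 ≠ a ∧ (l v).2 ∉ U ∧ (v ∉ U → rank (l v).2 < rank v) ∧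
      (l v).1 = op (l (l v).2).1 (A (l v).2 v))

/-- One round of the loop preserves the invariant: `v` is settled and its outgoing edges are
relaxed. -/
theorem DijkstraInvariant.settle {op : WithTop K → WithTop K → WithTop K}
    {A : V → V → WithTop K} {z : WithTop K} {a : V} {U : List V} {l : V → WithTop K × V}
    {rank : V → ℕ} (h : DijkstraInvariant op A z a U l rank)
    (hop : ∀ d e, z ≤ d → z ≤ e → d ≤ op d e ∧ e ≤ op d e) (hA : ∀ u v, z ≤ A u v)
    {v : V} (hv : v ∈ U) (hmin : ∀ u ∈ U, (l v).1 ≤ (l u).1) :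
    DijkstraInvariant op A z a (U.erase v)
      (fun u => if u ∈ U.erase v ∧ op (l v).1 (A v u) < (l u).1 then
        (op (l v).1 (A v u), v) else l u)
      (Function.update rank v (FinEnum.card V - U.length)) := by
  have hmem (u : V) : u ∈ U.erase v ↔ u ≠ v ∧ u ∈ U := h.nodup.mem_erase_iff
  have hlen : (U.erase v).length + 1 = U.length := by
    rw [List.length_erase_of_mem hv]
    have := List.length_pos_of_mem hv
    omega
  generalize hl' : (fun u => if u ∈ U.erase v ∧ op (l v).1 (A v u) < (l u).1 then
        (op (l v).1 (A v u), v) else l u) = l'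
  have hdef (u : V) : l' u = if u ∈ U.erase v ∧ op (l v).1 (A v u) < (l u).1 then
        (op (l v).1 (A v u), v) else l u := by rw [← hl']
  have hsame (u : V) (hu : u ∉ U.erase v) : l' u = l u := by
    rw [hdef, if_neg fun hc => hu hc.1]
  have hvv : l' v = l v := hsame v (by simp [hmem])
  have hle (u : V) : (l' u).1 ≤ (l u).1 := by
    rw [hdef]
    split_ifs with hc
    exacts [hc.2.le, le_rfl]
  have hd (u : V) : (l v).1 ≤ op (l v).1 (A v u) := (hop _ _ (h.le_label v) (hA v u)).1
  have hge (u : V) (hu : u ∈ U) : (l v).1 ≤ (l' u).1 := by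
    rw [hdef]
    split_ifs with hc
    exacts [hd u, hmin u hu]
  have hset (u : V) (hu : u ∉ U) : u ∉ U.erase v := fun hc => hu ((hmem u).1 hc).2
  have hor (u : V) (hu : u ∉ U.erase v) : u = v ∨ u ∉ U := by
    rw [hmem] at hu
    tauto
  refine ⟨h.nodup.erase v, by have := h.length_le; omega, fun u => ?_, fun u hu w hw => ?_,
    fun u hu w => ?_, fun u => (hle u).trans (h.le_edge u), fun u hu => ?_, fun u => ?_⟩
  · by_cases hu : u ∈ U
    · exact (h.le_label v).trans (hge u hu)
    · rw [hsame u (hset u hu)]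
      exact h.le_label u
  · have hw' := ((hmem w).1 hw).2
    rw [hsame u hu]
    rcases hor u hu with rfl | hu'
    · exact hge w hw'
    · exact (h.settled_le u hu' v hv).trans (hge w hw')
  · rw [hsame u hu]
    rcases hor u hu with rfl | hu'
    · by_cases hw : w ∈ U.erase u
      · rw [hdef]
        split_ifs with hc
        · exact le_rfl
        · exact not_lt.1 fun hlt => hc ⟨hw, hlt⟩
      · rw [hsame w hw]
        rcases hor w hw with rfl | hw'
        · exact hd w
        · exact (h.settled_le w hw' u hv).trans (hd w)
    · exact (hle w).trans (h.relaxed u hu' w)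
  · rcases hor u hu with rfl | hu'
    · rw [Function.update_self]
      have := h.length_le
      omega
    · rw [Function.update_of_ne (by rintro rfl; exact hu' hv)]
      have := h.rank_lt u hu'
      omega
  · by_cases hc : u ∈ U.erase v ∧ op (l v).1 (A v u) < (l u).1
    · have hu : l' u = (op (l v).1 (A v u), v) := by rw [hdef, if_pos hc]
      refine Or.inr ⟨?_, ?_, fun hn => (hn hc.1).elim, ?_⟩
      · rw [hu]
        -- An edge of the source is never improved by a detour through the source itself.
        rintro rfl
        exact absurd ((h.le_edge u).trans (hop _ _ (h.le_label v) (hA v u)).2) (not_le.2 hc.2)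
      · rw [hu]
        simp [hmem]
      · rw [hu, hvv]
    · have hu : l' u = l u := by rw [hdef, if_neg hc]
      rw [hu]
      refine (h.pred u).imp id fun hp => ?_
      obtain ⟨hp1, hp2, hp3, hp4⟩ := hp
      refine ⟨hp1, hset _ hp2, fun hn => ?_, ?_⟩
      · rw [Function.update_of_ne (a := (l u).2) (by rintro rfl; exact hp2 hv)]
        rcases hor u hn with rfl | hn'
        · rw [Function.update_self]
          have := h.rank_lt _ hp2
          omega
        · rw [Function.update_of_ne (by rintro rfl; exact hn' hv)]
          exact hp3 hn'
      · rw [hsame _ (hset _ hp2)]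
        exact hp4

theorem DijkstraInvariant.loop {op : WithTop K → WithTop K → WithTop K}
    {A : V → V → WithTop K} {z : WithTop K} {a : V}
    (hop : ∀ d e, z ≤ d → z ≤ e → d ≤ op d e ∧ e ≤ op d e) (hA : ∀ u v, z ≤ A u v)
    (n : ℕ) {U : List V} {l : V → WithTop K × V} {rank : V → ℕ}
    (h : DijkstraInvariant op A z a U l rank) (hn : U.length = n) :
    ∃ rank', DijkstraInvariant op A z a [] (dijkstraLoop op A n U l) rank' := by
  induction n generalizing U l rank with
  | zero =>
    obtain rfl := List.length_eq_zero_iff.1 hn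
    exact ⟨rank, h⟩
  | succ n ih =>
    rw [dijkstraLoop]
    cases hm : U.argmin (fun v => (l v).1) with
    | none =>
      rw [List.argmin_eq_none] at hm
      simp [hm] at hn
    | some v =>
      have hv : v ∈ U := List.argmin_mem hm
      refine ih (h.settle hop hA hv fun u hu => List.le_of_mem_argmin (f := fun v => (l v).1) hu hm) ?_
      rw [List.length_erase_of_mem hv, hn, Nat.add_sub_cancel]

theorem dijkstra_invariant {op : WithTop K → WithTop K → WithTop K} {A : V → V → WithTop K}
    {z : WithTop K} (hop : ∀ d e, z ≤ d → z ≤ e → d ≤ op d e ∧ e ≤ op d e)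
    (hA : ∀ u v, z ≤ A u v) (a : V) :
    ∃ rank, DijkstraInvariant op A z a [] (dijkstra op A a) rank := by
  have hlen : (FinEnum.toList V).length = FinEnum.card V := by simp [FinEnum.toList]
  refine DijkstraInvariant.loop hop hA _ (rank := 0) ⟨FinEnum.nodup_toList, hlen.le,
    fun v => hA a v, ?_, ?_, fun v => le_rfl, ?_, fun v => Or.inl rfl⟩ hlen
  all_goals exact fun u hu => (hu (FinEnum.mem_toList u)).elim

theorem DijkstraInvariant.opPath_tracePath {op : WithTop K → WithTop K → WithTop K}
    {A : V → V → WithTop K} {z : WithTop K} {a : V} {l : V → WithTop K × V} {rank : V → ℕ}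
    (h : DijkstraInvariant op A z a [] l rank) (n : ℕ) (v : V) (hn : rank v < n) :
    OpPath op A a (tracePath (fun u => (l u).2) a n v) v (l v).1 := by
  induction n generalizing v with
  | zero => omega
  | succ n ih =>
    rw [tracePath]
    rcases h.pred v with hp | ⟨hp1, -, hp3, hp4⟩
    · rw [hp, if_pos rfl]
      exact .single v
    · rw [if_neg hp1, hp4]
      exact (ih _ (by have := hp3 (by simp); omega)).snoc v

/-- The path found by Dijkstra's algorithm has the computed length. -/
theorem opPath_dijkstra {op : WithTop K → WithTop K → WithTop K} {A : V → V → WithTop K}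
    {z : WithTop K} (hop : ∀ d e, z ≤ d → z ≤ e → d ≤ op d e ∧ e ≤ op d e)
    (hA : ∀ u v, z ≤ A u v) (a v : V) :
    OpPath op A a (extractPath (dijkstra op A a) a v) v (dijkstra op A a v).1 := by
  obtain ⟨rank, h⟩ := dijkstra_invariant hop hA a
  exact h.opPath_tracePath _ v (by simpa using h.rank_lt v (by simp))

theorem dijkstra_le_edge {op : WithTop K → WithTop K → WithTop K} {A : V → V → WithTop K}
    {z : WithTop K} (hop : ∀ d e, z ≤ d → z ≤ e → d ≤ op d e ∧ e ≤ op d e)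
    (hA : ∀ u v, z ≤ A u v) (a v : V) : (dijkstra op A a v).1 ≤ A a v := by
  obtain ⟨rank, h⟩ := dijkstra_invariant hop hA a
  exact h.le_edge v

theorem dijkstra_le_op {op : WithTop K → WithTop K → WithTop K} {A : V → V → WithTop K}
    {z : WithTop K} (hop : ∀ d e, z ≤ d → z ≤ e → d ≤ op d e ∧ e ≤ op d e)
    (hA : ∀ u v, z ≤ A u v) (a u v : V) :
    (dijkstra op A a v).1 ≤ op (dijkstra op A a u).1 (A u v) := by
  obtain ⟨rank, h⟩ := dijkstra_invariant hop hA a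
  exact h.relaxed u (by simp) v

theorem le_dijkstra {op : WithTop K → WithTop K → WithTop K} {A : V → V → WithTop K}
    {z : WithTop K} (hop : ∀ d e, z ≤ d → z ≤ e → d ≤ op d e ∧ e ≤ op d e)
    (hA : ∀ u v, z ≤ A u v) (a v : V) : z ≤ (dijkstra op A a v).1 := by
  obtain ⟨rank, h⟩ := dijkstra_invariant hop hA a
  exact h.le_label v

end Dijkstra

/-! ### Paths in weighted graphs and the cycle of a triple -/

section Paths

variable {V : Type*}

/-- `IsPath A a p v d`: there is a path of length `d` from `a` to `v` in the graph `A`, whose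
vertices without the last one `v` are listed in `p`. -/
inductive IsPath (A : V → V → WithTop ℝ) : V → List V → V → ℝ → Prop
  | nil (a : V) : IsPath A a [] a 0
  | cons {a b v : V} {w d : ℝ} {p : List V} (h : A a b = w) (hp : IsPath A b p v d) :
      IsPath A a (a :: p) v (w + d)

theorem IsPath.append {A : V → V → WithTop ℝ} {a b v : V} {p q : List V} {d e : ℝ}
    (h : IsPath A a p b d) (h' : IsPath A b q v e) : IsPath A a (p ++ q) v (d + e) := by
  induction h with
  | nil a => simpa using h'
  | cons hw _ ih =>
    rw [add_assoc]
    exact .cons hw (ih h')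

theorem IsPath.single {A : V → V → WithTop ℝ} {a b : V} {w : ℝ} (h : A a b = w) :
    IsPath A a [a] b w := by
  simpa using IsPath.cons h (.nil b)

theorem IsPath.mem {A : V → V → WithTop ℝ} {a v : V} {p : List V} {d : ℝ}
    (h : IsPath A a p v d) (hp : p ≠ []) : a ∈ p := by
  cases h
  · exact (hp rfl).elim
  · simp

theorem IsPath.eq_of_nil {A : V → V → WithTop ℝ} {a v : V} {d : ℝ} (h : IsPath A a [] v d) :
    a = v := by
  cases h
  rfl

/-- `SWalk A S C a p v`: there is a path from `a` to `v`, with vertices `p` followed by `v`, that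
is composed of segments of length at most `C`, each of which ends in `S`. -/
inductive SWalk (A : V → V → WithTop ℝ) (S : V → Bool) (C : ℝ) : V → List V → V → Prop
  | nil (a : V) : SWalk A S C a [] a
  | cons {a b v : V} {d : ℝ} {p q : List V} (h : IsPath A a p b d) (hd : d ≤ C) (hb : S b = true)
      (h' : SWalk A S C b q v) : SWalk A S C a (p ++ q) v

theorem SWalk.append {A : V → V → WithTop ℝ} {S : V → Bool} {C : ℝ} {a b v : V} {p q : List V}
    (h : SWalk A S C a p b) (h' : SWalk A S C b q v) : SWalk A S C a (p ++ q) v := by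
  induction h with
  | nil a => simpa using h'
  | cons hp hd hb _ ih =>
    rw [List.append_assoc]
    exact .cons hp hd hb (ih h')

theorem SWalk.single {A : V → V → WithTop ℝ} {S : V → Bool} {C : ℝ} {a b : V} {p : List V} {d : ℝ}
    (h : IsPath A a p b d) (hd : d ≤ C) (hb : S b = true) : SWalk A S C a p b := by
  simpa using SWalk.cons h hd hb (.nil b)

theorem SWalk.isPath {A : V → V → WithTop ℝ} {S : V → Bool} {C : ℝ} {a v : V} {p : List V}
    (h : SWalk A S C a p v) : ∃ d, IsPath A a p v d := by
  induction h with
  | nil a => exact ⟨0, .nil a⟩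
  | cons hp _ _ _ ih =>
    obtain ⟨e, he⟩ := ih
    exact ⟨_, hp.append he⟩

theorem OpPath.isPath {A : V → V → WithTop ℝ} {a v : V} {p : List V} {D : WithTop ℝ}
    (h : OpPath (· + ·) A a p v D) {d : ℝ} (hd : D = d) : IsPath A a p v d := by
  induction h generalizing d with
  | single v => exact .single hd
  | snoc v _ ih =>
    obtain ⟨x, y, hx, hy, rfl⟩ := WithTop.add_eq_coe.1 hd
    exact (ih hx.symm).append (.single hy.symm)

theorem add_hop (d e : WithTop ℝ) (hd : 0 ≤ d) (he : 0 ≤ e) : d ≤ d + e ∧ e ≤ d + e :=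
  ⟨le_add_of_nonneg_right he, le_add_of_nonneg_left hd⟩

theorem max_hop (d e : WithTop ℝ) (_ : 0 ≤ d) (_ : 0 ≤ e) : d ≤ max d e ∧ e ≤ max d e :=
  ⟨le_max_left d e, le_max_right d e⟩

variable [FinEnum V] {A : V → V → WithTop ℝ}

theorem opPath_shortestPath (hA : ∀ u v, 0 ≤ A u v) (a v : V) :
    OpPath (· + ·) A a (extractPath (shortestPath A a) a v) v (shortestPath A a v).1 :=
  opPath_dijkstra add_hop hA a v

theorem isPath_shortestPath (hA : ∀ u v, 0 ≤ A u v) {a v : V} {d : ℝ}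
    (hd : (shortestPath A a v).1 = d) :
    IsPath A a (extractPath (shortestPath A a) a v) v d :=
  (opPath_shortestPath hA a v).isPath hd

theorem isPath_path₀ (hA : ∀ u v, 0 ≤ A u v) {a v : V} {d : ℝ} (hd : dist₀ A a v = d) :
    IsPath A a (path₀ A a v) v d := by
  unfold dist₀ at hd
  unfold path₀
  split_ifs at hd ⊢ with h
  · obtain rfl : (0 : ℝ) = d := by exact_mod_cast hd
    exact h ▸ .nil a
  · exact isPath_shortestPath hA hd

theorem graphOn_nonneg (hA : ∀ u v, 0 ≤ A u v) (S : V → Bool) (s t : V) :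
    0 ≤ graphOn A S s t := by
  unfold graphOn
  split_ifs
  · exact le_dijkstra add_hop hA s t
  · exact le_top

theorem sWalk_of_graphOn_le (hA : ∀ u v, 0 ≤ A u v) {S : V → Bool} {s t : V} {C : ℝ}
    (h : graphOn A S s t ≤ C) :
    SWalk A S C s (extractPath (shortestPath A s) s t) t := by
  unfold graphOn at h
  split_ifs at h with hst
  · obtain ⟨d, hd⟩ := WithTop.ne_top_iff_exists.1 (ne_top_of_le_ne_top WithTop.coe_ne_top h)
    rw [← hd, WithTop.coe_le_coe] at h
    exact .single (isPath_shortestPath hA hd.symm) h (by simpa using (Bool.and_eq_true _ _ ▸ hst).2)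
  · simp at h

/-- Replacing the edges of a path in `G_S` with bottleneck length at most `C` by shortest paths
gives a path with segments of length at most `C`. -/
theorem OpPath.sWalk (hA : ∀ u v, 0 ≤ A u v) {S : V → Bool} {s t : V} {C : ℝ} {b : List V}
    {D : WithTop ℝ} (h : OpPath max (graphOn A S) s b t D) (hD : D ≤ C) :
    SWalk A S C s ((b.zip (b.tail ++ [t])).flatMap
      fun e => extractPath (shortestPath A e.1) e.1 e.2) t := by
  induction h with
  | single t => simpa using sWalk_of_graphOn_le hA hD
  | @snoc p u d t h ih =>
    obtain ⟨hD1, hD2⟩ := max_le_iff.1 hD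
    have hzip : (p ++ [u]).zip ((p ++ [u]).tail ++ [t]) = p.zip (p.tail ++ [u]) ++ [(u, t)] := by
      rw [List.tail_append_of_ne_nil h.ne_nil, List.zip_append]
      · rfl
      · have := List.length_pos_of_ne_nil h.ne_nil
        simp
        omega
    rw [hzip, List.flatMap_append]
    exact (ih hD1).append (by simpa using sWalk_of_graphOn_le hA hD2)

theorem sWalk_bottleneckPath (hA : ∀ u v, 0 ≤ A u v) {S : V → Bool} {s t : V} {C : ℝ}
    (h : (shortestBotPath (graphOn A S) s t).1 ≤ C) :
    SWalk A S C s (bottleneckPath A S s t) t :=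
  (opPath_dijkstra max_hop (graphOn_nonneg hA S) s t).sWalk hA h

theorem bottleneckPath_ne_nil (hA : ∀ u v, 0 ≤ A u v) (S : V → Bool) (s t : V) :
    bottleneckPath A S s t ≠ [] := by
  have h := (opPath_dijkstra max_hop (graphOn_nonneg hA S) s t).ne_nil
  unfold bottleneckPath
  simp only [shortestBotPath]
  revert h
  generalize extractPath (dijkstra max (graphOn A S) s) s t = b
  cases b with
  | nil => simp
  | cons x b =>
    intro _
    rcases hb : b ++ [t] with _ | ⟨y, b'⟩
    · simp at hb
    · simp [hb, (opPath_shortestPath hA x y).ne_nil]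

/-- The cycle of a triple of cost `C` passes through the first vertex of the triple, and up to
rotation it is composed of segments of length at most `C` that end in `S`. -/
theorem sWalk_tripleCycle (hA : ∀ u v, 0 ≤ A u v) {S : V → Bool} {f s₁ s₂ : V}
    (hs₁ : S s₁ = true) {C : ℝ} (hC : tripleCost A S (f, s₁, s₂) = C) :
    f ∈ tripleCycle A S (f, s₁, s₂) ∧
      ∃ c, (tripleCycle A S (f, s₁, s₂)).IsRotated c ∧ SWalk A S C s₁ c s₁ := by
  have hle : dist₀ A f s₁ + dist₀ A s₂ f ≤ C := by
    rw [← hC]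
    simp only [tripleCost]
    split_ifs
    exacts [le_rfl, le_max_left _ _]
  obtain ⟨x, hx⟩ := WithTop.ne_top_iff_exists.1 (ne_top_of_le_ne_top WithTop.coe_ne_top hle)
  obtain ⟨d, e, hd, he, rfl⟩ := WithTop.add_eq_coe.1 hx.symm
  rw [← hx, WithTop.coe_le_coe] at hle
  have hp := isPath_path₀ hA hd.symm
  have hq := isPath_path₀ hA he.symm
  have hqp : SWalk A S C s₂ (path₀ A s₂ f ++ path₀ A f s₁) s₁ :=
    .single (hq.append hp) (by linarith) hs₁
  have hf : f ≠ s₁ → f ∈ path₀ A f s₁ := fun h => hp.mem fun h0 => h (h0 ▸ hp).eq_of_nil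
  simp only [tripleCycle]
  split_ifs with h
  · obtain ⟨h1, rfl⟩ := h
    refine ⟨by simp [hf h1], _, ?_, hqp⟩
    rw [List.append_nil]
    exact List.isRotated_append
  · simp only [tripleCost] at hC
    rw [if_neg h] at hC
    have hb := sWalk_bottleneckPath hA (S := S) (C := C) (hC ▸ le_max_right _ _)
    refine ⟨?_, _, ?_, hb.append hqp⟩
    · by_cases h1 : f = s₁
      · obtain ⟨y, hy⟩ := hb.isPath
        have := hy.mem (bottleneckPath_ne_nil hA S s₁ s₂)
        simp [h1, this]
      · simp [hf h1]
    · rw [List.append_assoc, ← List.append_assoc (bottleneckPath A S s₁ s₂)]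
      exact List.isRotated_append

/-- Min-Bottleneck-Cycle returns the cycle of a triple of least cost as soon as some triple has
finite cost. -/
theorem minBottleneckCycle_eq_some {S F : V → Bool} {f s₁ s₂ : V} (hf : F f = true)
    (hs₁ : S s₁ = true) (hs₂ : S s₂ = true) (hC : tripleCost A S (f, s₁, s₂) < ⊤) :
    ∃ f s₁ s₂, ∃ C : ℝ, minBottleneckCycle A S F = some (tripleCycle A S (f, s₁, s₂)) ∧
      F f = true ∧ S s₁ = true ∧ tripleCost A S (f, s₁, s₂) = C ∧
      ∀ f s₁ s₂, F f = true → S s₁ = true → S s₂ = true →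
        (C : WithTop ℝ) ≤ tripleCost A S (f, s₁, s₂) := by
  unfold minBottleneckCycle
  simp only
  have hmem (f s₁ s₂ : V) : (f, s₁, s₂) ∈ ((FinEnum.toList V).filter F).product
      (((FinEnum.toList V).filter S).product ((FinEnum.toList V).filter S)) ↔
        F f = true ∧ S s₁ = true ∧ S s₂ = true := by
    simp
  revert hmem
  generalize ((FinEnum.toList V).filter F).product
      (((FinEnum.toList V).filter S).product ((FinEnum.toList V).filter S)) = l
  intro hmem
  cases hm : l.argmin (tripleCost A S) with
  | none =>
    rw [List.argmin_eq_none] at hm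
    simpa [hm, hf, hs₁, hs₂] using hmem f s₁ s₂
  | some x =>
    obtain ⟨g, t₁, t₂⟩ := x
    have hmin (f s₁ s₂ : V) (h1 : F f = true) (h2 : S s₁ = true) (h3 : S s₂ = true) :
        tripleCost A S (g, t₁, t₂) ≤ tripleCost A S (f, s₁, s₂) :=
      List.le_of_mem_argmin ((hmem f s₁ s₂).2 ⟨h1, h2, h3⟩) hm
    have hlt := (hmin f s₁ s₂ hf hs₁ hs₂).trans_lt hC
    obtain ⟨C, hC'⟩ := WithTop.ne_top_iff_exists.1 hlt.ne
    obtain ⟨h1, h2, -⟩ := (hmem _ _ _).1 (List.argmin_mem hm)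
    refine ⟨g, t₁, t₂, C, by simp [hlt.ne], h1, h2, hC'.symm, ?_⟩
    rw [hC']
    exact hmin

end Paths

/-! ### Infinite walks -/

section InfiniteWalks

variable {V : Type*}

/-- The length of the part of the infinite sequence `τ` between the positions `n` and `m`. -/
def seqLength (w : V → V → ℝ) (τ : ℕ → V) (n m : ℕ) : ℝ :=
  ∑ i ∈ Finset.Ico n m, w (τ i) (τ (i + 1))

theorem seqLength_self (w : V → V → ℝ) (τ : ℕ → V) (n : ℕ) : seqLength w τ n n = 0 := by
  simp [seqLength]

theorem seqLength_succ (w : V → V → ℝ) (τ : ℕ → V) {n m : ℕ} (h : n ≤ m) :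
    seqLength w τ n (m + 1) = seqLength w τ n m + w (τ m) (τ (m + 1)) :=
  Finset.sum_Ico_succ_top h _

theorem seqLength_add (w : V → V → ℝ) (τ : ℕ → V) {n m k : ℕ} (h : n ≤ m) (h' : m ≤ k) :
    seqLength w τ n m + seqLength w τ m k = seqLength w τ n k :=
  Finset.sum_Ico_consecutive _ h h'

theorem seqLength_shift (w : V → V → ℝ) (τ : ℕ → V) (k n m : ℕ) :
    seqLength w (fun i => τ (i + k)) n m = seqLength w τ (n + k) (m + k) := by
  simp only [seqLength]
  rw [← Finset.sum_Ico_add' (fun i => w (τ i) (τ (i + 1)))]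
  simp only [Nat.add_right_comm]

theorem seqLength_nonneg {w : V → V → ℝ} {τ : ℕ → V} {n m : ℕ}
    (h : ∀ i, n ≤ i → i < m → 0 ≤ w (τ i) (τ (i + 1))) : 0 ≤ seqLength w τ n m :=
  Finset.sum_nonneg fun i hi => h i (Finset.mem_Ico.1 hi).1 (Finset.mem_Ico.1 hi).2

theorem IsPath.eq_head {A : V → V → WithTop ℝ} {a v x : V} {p : List V} {d : ℝ}
    (h : IsPath A a p v d) (hx : p[0]? = some x) : x = a := by
  cases h <;> simp_all

/-- If the sequence `τ` starts with a path, then it follows edges there, and its length is that of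
the path. -/
theorem IsPath.of_reads {A : V → V → WithTop ℝ} {w : V → V → ℝ}
    (hw : ∀ u v (x : ℝ), A u v = x → w u v = x) {a v : V} {p : List V} {d : ℝ}
    (h : IsPath A a p v d) {τ : ℕ → V} (hτ : ∀ i < p.length, p[i]? = some (τ i))
    (hv : τ p.length = v) :
    τ 0 = a ∧ (∀ i < p.length, A (τ i) (τ (i + 1)) ≠ ⊤) ∧ seqLength w τ 0 p.length = d := by
  induction h generalizing τ with
  | nil a => exact ⟨hv, by simp, by simp [seqLength]⟩
  | @cons a b v x d p hx hp ih =>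
    have h0 : τ 0 = a := by simpa using (hτ 0 (by simp)).symm
    obtain ⟨h1, h2, h3⟩ := ih (τ := fun i => τ (i + 1))
      (fun i hi => by simpa using hτ (i + 1) (by simpa using hi)) (by simpa using hv)
    rw [Nat.zero_add] at h1
    refine ⟨h0, fun i hi => ?_, ?_⟩
    · rcases i with _ | i
      · rw [h0, h1, hx]
        exact WithTop.coe_ne_top
      · exact h2 i (by simpa using hi)
    · rw [seqLength_shift] at h3
      rw [← seqLength_add w τ (Nat.zero_le 1) (by simp), List.length_cons, ← h3,
        seqLength_succ w τ le_rfl, seqLength_self, h0, h1, hw _ _ _ hx]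
      simp

/-- If the sequence `τ` starts with a path composed of segments of length at most `C` that end in
`S`, then from every position in it the next visit of `S` is at distance at most `C`. -/
theorem SWalk.of_reads {A : V → V → WithTop ℝ} {w : V → V → ℝ}
    (hA : ∀ u v, 0 ≤ A u v) (hw : ∀ u v (x : ℝ), A u v = x → w u v = x) {S : V → Bool} {C : ℝ}
    {a v : V} {p : List V} (h : SWalk A S C a p v) {τ : ℕ → V}
    (hτ : ∀ i < p.length, p[i]? = some (τ i)) (hv : τ p.length = v) :
    ∀ n < p.length, ∃ m > n, S (τ m) = true ∧ seqLength w τ n m ≤ C := by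
  induction h generalizing τ with
  | nil a => simp
  | @cons a b v d p q hp hd hb hq ih =>
    have hτq : ∀ i < q.length, q[i]? = some (τ (i + p.length)) := fun i hi => by
      have := hτ (i + p.length) (by simp; omega)
      rwa [List.getElem?_append_right (by omega), Nat.add_sub_cancel] at this
    have hvq : τ (q.length + p.length) = v := by
      rw [← hv, List.length_append, Nat.add_comm]
    obtain ⟨e, he⟩ := hq.isPath
    have hpb := (he.of_reads hw (τ := fun i => τ (i + p.length)) hτq hvq).1
    rw [Nat.zero_add] at hpb
    obtain ⟨-, h2, h3⟩ := hp.of_reads hw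
      (fun i hi => by
        have := hτ i (by simp; omega)
        rwa [List.getElem?_append_left hi] at this) hpb
    intro n hn
    rcases Nat.lt_or_ge n p.length with hnp | hnp
    · refine ⟨p.length, hnp, by rw [hpb, hb], ?_⟩
      have h4 := seqLength_add w τ (Nat.zero_le n) hnp.le
      have h5 : 0 ≤ seqLength w τ 0 n := seqLength_nonneg fun i _ hi => by
        obtain ⟨x, hx⟩ := WithTop.ne_top_iff_exists.1 (h2 i (by omega))
        rw [hw _ _ _ hx.symm]
        exact_mod_cast hx ▸ hA (τ i) (τ (i + 1))
      linarith
    · obtain ⟨m, hm, hm1, hm2⟩ := ih (τ := fun i => τ (i + p.length)) hτq hvq (n - p.length)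
        (by simp at hn; omega)
      rw [seqLength_shift, Nat.sub_add_cancel hnp] at hm2
      exact ⟨m + p.length, by omega, hm1, hm2⟩

/-- Following a closed walk forever: the sequence follows edges, and from every position the next
visit of `S` is at distance at most `C`. -/
theorem SWalk.periodic {A : V → V → WithTop ℝ} {w : V → V → ℝ}
    (hA : ∀ u v, 0 ≤ A u v) (hw : ∀ u v (x : ℝ), A u v = x → w u v = x) {S : V → Bool} {C : ℝ}
    {s : V} {c : List V} (h : SWalk A S C s c s) (hc : c ≠ []) (d : V) (n : ℕ) :
    A (c.getD (n % c.length) d) (c.getD ((n + 1) % c.length) d) ≠ ⊤ ∧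
      ∃ m > n, S (c.getD (m % c.length) d) = true ∧
        seqLength w (fun i => c.getD (i % c.length) d) n m ≤ C := by
  have hpos := List.length_pos_of_ne_nil hc
  generalize hσ : (fun i => c.getD (i % c.length) d) = σ
  have hσ' (i : ℕ) : c.getD (i % c.length) d = σ i := by rw [← hσ]
  have hread : ∀ i < c.length, (c)[i]? = some (σ i) := fun i hi => by
    rw [← hσ', Nat.mod_eq_of_lt hi, List.getD_eq_getElem _ _ hi, List.getElem?_eq_getElem hi]
  have hper (i : ℕ) : σ (i + c.length * (n / c.length)) = σ i := by
    rw [← hσ', ← hσ', Nat.add_mul_mod_self_left]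
  obtain ⟨e, he⟩ := h.isPath
  have hend : σ c.length = s := by
    rw [← he.eq_head (hread 0 hpos), ← hσ', ← hσ', Nat.mod_self, Nat.zero_mod]
  have hlt := Nat.mod_lt n hpos
  have hn := Nat.mod_add_div n c.length
  simp only [hσ']
  constructor
  · have h1 := (he.of_reads hw hread hend).2.1 _ hlt
    rw [← hper (n % c.length), ← hper (n % c.length + 1), Nat.add_right_comm, hn] at h1
    exact h1
  · obtain ⟨m, hm, hm1, hm2⟩ := h.of_reads hA hw hread hend _ hlt
    refine ⟨m + c.length * (n / c.length), by omega, by rw [hper, hm1], ?_⟩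
    have h1 := seqLength_shift w σ (c.length * (n / c.length)) (n % c.length) m
    rw [hn] at h1
    rw [← h1]
    simpa only [hper] using hm2

theorem lasso_add {d : V} {pre cyc c : List V} {j : ℕ} (hj : c.rotate j = cyc) (hc : c ≠ [])
    (n : ℕ) : lasso d pre cyc (n + pre.length) = c.getD ((n + j) % c.length) d := by
  subst hj
  unfold lasso
  rw [if_neg (by omega), Nat.add_sub_cancel, List.length_rotate, List.getD_eq_getElem?_getD,
    List.getElem?_rotate (Nat.mod_lt _ (List.length_pos_of_ne_nil hc)), Nat.mod_add_mod,
    List.getD_eq_getElem?_getD]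

/-- The sequence that follows a path from `i` to `x` and then repeats a closed walk that starts
in `x`. -/
theorem SWalk.lasso {A : V → V → WithTop ℝ} {w : V → V → ℝ}
    (hA : ∀ u v, 0 ≤ A u v) (hw : ∀ u v (x : ℝ), A u v = x → w u v = x) {S : V → Bool} {C : ℝ}
    {s i x f : V} {c pre cyc : List V} (h : SWalk A S C s c s) (hrot : c.IsRotated cyc)
    (hx : cyc[0]? = some x) (hf : f ∈ cyc) {e : ℝ} (hpre : IsPath A i pre x e) (d : V) :
    lasso d pre cyc 0 = i ∧
      (∀ n, A (lasso d pre cyc n) (lasso d pre cyc (n + 1)) ≠ ⊤) ∧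
      (∃ᶠ n in atTop, lasso d pre cyc n = f) ∧
      ∀ᶠ n in atTop, ∃ m > n, S (lasso d pre cyc m) = true ∧
        seqLength w (lasso d pre cyc) n m ≤ C := by
  have hfc : f ∈ c := hrot.mem_iff.2 hf
  have hc : c ≠ [] := List.ne_nil_of_mem hfc
  obtain ⟨j, hj⟩ := hrot
  have hpos : 0 < cyc.length := List.length_pos_of_mem hf
  have hadd := lasso_add (d := d) (pre := pre) hj hc
  have hpx : _root_.lasso d pre cyc pre.length = x := by
    simp [_root_.lasso, hx]
  have hread : ∀ k < pre.length, pre[k]? = some (_root_.lasso d pre cyc k) := fun k hk => by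
    simp [_root_.lasso, hk]
  obtain ⟨h0, h1, -⟩ := hpre.of_reads hw hread hpx
  refine ⟨h0, fun n => ?_, ?_, ?_⟩
  · rcases Nat.lt_or_ge n pre.length with hn | hn
    · exact h1 n hn
    · obtain ⟨k, rfl⟩ := Nat.exists_eq_add_of_le' hn
      rw [Nat.add_right_comm, hadd, hadd, Nat.add_right_comm]
      exact (h.periodic hA hw hc d (k + j)).1
  · obtain ⟨k, hk, hkf⟩ := List.mem_iff_getElem.1 hfc
    rw [frequently_atTop]
    intro N
    have hle : (N + j) * 1 ≤ (N + j) * c.length := Nat.mul_le_mul_left _ (by omega)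
    refine ⟨k + (N + j) * c.length - j + pre.length, by omega, ?_⟩
    rw [hadd, Nat.sub_add_cancel (by omega), Nat.add_mul_mod_self_right, Nat.mod_eq_of_lt hk,
      List.getD_eq_getElem _ _ hk, hkf]
  · filter_upwards [eventually_ge_atTop pre.length] with n hn
    obtain ⟨k, rfl⟩ := Nat.exists_eq_add_of_le' hn
    obtain ⟨m, hm, hm1, hm2⟩ := (h.periodic hA hw hc d (k + j)).2
    refine ⟨m - j + pre.length, by omega, ?_, ?_⟩
    · rw [hadd, Nat.sub_add_cancel (by omega)]
      exact hm1
    · rw [← seqLength_shift]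
      simp only [hadd]
      rw [seqLength_shift w (fun i => c.getD (i % c.length) d), Nat.sub_add_cancel (by omega)]
      exact hm2

variable [FinEnum V] {A : V → V → WithTop ℝ}

theorem shortestPath_le_seqLength (hA : ∀ u v, 0 ≤ A u v) {w : V → V → ℝ} {τ : ℕ → V}
    (hτ : ∀ n, A (τ n) (τ (n + 1)) = w (τ n) (τ (n + 1))) {n m : ℕ} (h : n < m) :
    (shortestPath A (τ n) (τ m)).1 ≤ seqLength w τ n m := by
  induction m, h using Nat.le_induction with
  | base =>
    rw [seqLength_succ w τ le_rfl, seqLength_self, zero_add, ← hτ]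
    exact dijkstra_le_edge add_hop hA _ _
  | succ m hm ih =>
    rw [seqLength_succ w τ (by omega), WithTop.coe_add, ← hτ]
    exact (dijkstra_le_op add_hop hA (τ n) (τ m) (τ (m + 1))).trans
      (add_le_add ih le_rfl)

/-- The lower bound: if an infinite walk visits `f` infinitely often, and from some point on its
distances between successive visits of `S` are less than `M`, then some triple with first vertex
`f` has cost less than `M`. If `f` is not in `S`, two visits of `f` have to be chosen that agree in
the preceding and in the following visit of `S`, because the two summands of the cost of a triple
come from different visits of `f`. -/
theorem exists_tripleCost_lt (hA : ∀ u v, 0 ≤ A u v) {w : V → V → ℝ} {τ : ℕ → V}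
    (hτ : ∀ n, A (τ n) (τ (n + 1)) = w (τ n) (τ (n + 1))) {S : V → Bool} {o : ℕ → ℕ}
    (ho : StrictMono o) (hoS : ∀ i, S (τ (o i)) = true)
    (ho_succ : ∀ i n, n < o (i + 1) → S (τ n) = true → n ≤ o i)
    {f : V} (hf : ∃ᶠ n in atTop, τ n = f) {N : ℕ} {M : WithTop ℝ}
    (hM : ∀ i ≥ N, (seqLength w τ (o i) (o (i + 1)) : WithTop ℝ) < M) :
    ∃ s₁ s₂, S s₁ = true ∧ S s₂ = true ∧ tripleCost A S (f, s₁, s₂) < M := by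
  have hbot (a b : ℕ) (ha : N ≤ a) (hab : a < b) :
      (shortestBotPath (graphOn A S) (τ (o a)) (τ (o b))).1 < M := by
    have hedge (i : ℕ) (hi : N ≤ i) : graphOn A S (τ (o i)) (τ (o (i + 1))) < M := by
      rw [graphOn, if_pos (by simp [hoS])]
      exact (shortestPath_le_seqLength hA hτ (ho (Nat.lt_succ_self i))).trans_lt (hM i hi)
    induction b, hab using Nat.le_induction with
    | base => exact (dijkstra_le_edge max_hop (graphOn_nonneg hA S) _ _).trans_lt (hedge a ha)
    | succ b hb ih =>
      exact (dijkstra_le_op max_hop (graphOn_nonneg hA S) (τ (o a)) (τ (o b)) _).trans_lt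
        (max_lt ih (hedge b (by omega)))
  have hidx (n : ℕ) (hn : o N ≤ n) : ∃ i ≥ N, o i ≤ n ∧ n < o (i + 1) := by
    classical
    have hex : ∃ k, n < o k := ⟨n + 1, Nat.lt_of_succ_le (ho.le_apply (x := n + 1))⟩
    have h1 := Nat.find_spec hex
    have h2 : N < Nat.find hex := ho.lt_iff_lt.1 (hn.trans_lt h1)
    obtain ⟨i, hi⟩ := Nat.exists_eq_succ_of_ne_zero (n := Nat.find hex) (by omega)
    rw [hi] at h1 h2
    exact ⟨i, by omega, not_lt.1 (Nat.find_min hex (by omega)), h1⟩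
  obtain ⟨⟨s, t⟩, hst⟩ := exists_frequently_of_frequently_exists
    (p := fun n (x : V × V) => τ n = f ∧
      ∃ i ≥ N, o i ≤ n ∧ n < o (i + 1) ∧ τ (o i) = x.1 ∧ τ (o (i + 1)) = x.2)
    ((hf.and_eventually (eventually_ge_atTop (o N))).mono fun n hn => by
      obtain ⟨i, hi, h1, h2⟩ := hidx n hn.2
      exact ⟨(τ (o i), τ (o (i + 1))), hn.1, i, hi, h1, h2, rfl, rfl⟩)
  obtain ⟨n, hnf, i, hi, h1, h2, h3, h4⟩ := hst.exists
  obtain ⟨n', hn', hnf', i', hi', h1', h2', h3', h4'⟩ := frequently_atTop.1 hst (o (i + 1))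
  have hii : i < i' := by
    have := ho.lt_iff_lt.1 (hn'.trans_lt h2')
    omega
  by_cases hSf : S f = true
  · have e1 : n = o i := le_antisymm (ho_succ i n h2 (hnf ▸ hSf)) h1
    have e2 : n' = o i' := le_antisymm (ho_succ i' n' h2' (hnf' ▸ hSf)) h1'
    refine ⟨f, f, hSf, hSf, ?_⟩
    have hb := hbot i i' hi hii
    rw [← e1, ← e2, hnf, hnf'] at hb
    have hpos : (0 : WithTop ℝ) < M :=
      (le_dijkstra max_hop (graphOn_nonneg hA S) f f).trans_lt hb
    simpa [tripleCost, dist₀, hpos] using hb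
  · have hne (k : ℕ) : f ≠ τ (o k) := fun h => hSf (h ▸ hoS k)
    have hlt : o i < n := lt_of_le_of_ne h1 fun h => hne i (by rw [h, hnf])
    have hsum : dist₀ A f (τ (o (i + 1))) + dist₀ A (τ (o i')) f < M := by
      refine lt_of_le_of_lt ?_ (hM i hi)
      rw [dist₀, if_neg (hne _), dist₀, if_neg (hne _).symm, h3', ← h3, ← hnf,
        ← seqLength_add w τ h1 h2.le, WithTop.coe_add,
        add_comm (seqLength w τ (o i) n : WithTop ℝ)]
      exact add_le_add (shortestPath_le_seqLength hA hτ h2) (shortestPath_le_seqLength hA hτ hlt)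
    refine ⟨τ (o (i + 1)), τ (o i'), hoS _, hoS _, ?_⟩
    simp only [tripleCost]
    split_ifs with h
    · exact hsum
    · have hne' : i + 1 ≠ i' := fun he => h ⟨hne _, by rw [he]⟩
      exact max_lt hsum (hbot _ _ (by omega) (by omega))

end InfiniteWalks

/-! ### The run of the product automaton -/

section Product

variable {V : Type*}

theorem ProductAutomaton.graph_nonneg (P : ProductAutomaton V ℝ)
    (hw : ∀ u v, P.trans u v = true → 0 ≤ P.w u v) (u v : V) : 0 ≤ P.graph u v := by
  unfold ProductAutomaton.graph
  split_ifs with h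
  · exact_mod_cast hw u v h
  · exact le_top

variable [FinEnum V]

/-- If some triple has finite cost, then `optimalProductRun` returns a prefix and a cycle. The
corresponding sequence is an accepting run of the product automaton, in which the distance to the
next visit of a state with `prop` is eventually at most `C`, for a lower bound `C` of the costs of
all triples. -/
theorem optimalProductRun_eq_some (P : ProductAutomaton V ℝ)
    (hw : ∀ u v, P.trans u v = true → 0 ≤ P.w u v) {i f s₁ s₂ : V} (hi : P.init i = true)
    (hif : dist₀ P.graph i f ≠ ⊤) (hf : P.acc f = true) (hs₁ : P.prop s₁ = true)
    (hs₂ : P.prop s₂ = true) (hC : tripleCost P.graph P.prop (f, s₁, s₂) < ⊤) :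
    ∃ pre cyc, ∃ C : ℝ, optimalProductRun P = some (pre, cyc) ∧ cyc ≠ [] ∧
      (∀ d, P.init (lasso d pre cyc 0) = true ∧
        (∀ n, P.trans (lasso d pre cyc n) (lasso d pre cyc (n + 1)) = true) ∧
        (∃ f, P.acc f = true ∧ ∃ᶠ n in atTop, lasso d pre cyc n = f) ∧
        ∀ᶠ n in atTop, ∃ m > n, P.prop (lasso d pre cyc m) = true ∧
          seqLength P.w (lasso d pre cyc) n m ≤ C) ∧
      ∀ i f s₁ s₂, P.init i = true → dist₀ P.graph i f ≠ ⊤ → P.acc f = true →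
        P.prop s₁ = true → P.prop s₂ = true →
        (C : WithTop ℝ) ≤ tripleCost P.graph P.prop (f, s₁, s₂) := by
  have hA := P.graph_nonneg hw
  have hAw (u v : V) (x : ℝ) (h : P.graph u v = x) : P.w u v = x := by
    unfold ProductAutomaton.graph at h
    split_ifs at h
    · exact_mod_cast h
    · exact (WithTop.top_ne_coe h).elim
  have htrans (u v : V) (h : P.graph u v ≠ ⊤) : P.trans u v = true := by
    by_contra hn
    exact h (if_neg hn)
  unfold optimalProductRun
  simp only
  generalize hF : (fun f => P.acc f &&
    ((FinEnum.toList V).filter P.init).any fun i => decide (dist₀ P.graph i f ≠ ⊤)) = F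
  have hF' (f : V) : F f = true ↔
      P.acc f = true ∧ ∃ i, P.init i = true ∧ dist₀ P.graph i f ≠ ⊤ := by
    rw [← hF]
    simp
  obtain ⟨g, t₁, t₂, C, hcyc, hg, ht₁, hCeq, hmin⟩ :=
    minBottleneckCycle_eq_some ((hF' f).2 ⟨hf, i, hi, hif⟩) hs₁ hs₂ hC
  obtain ⟨hgacc, j, hj, hjg⟩ := (hF' g).1 hg
  obtain ⟨hgmem, c, hrot, hwalk⟩ := sWalk_tripleCycle hA ht₁ hCeq
  simp only [hcyc]
  generalize tripleCycle P.graph P.prop (g, t₁, t₂) = cyc at hgmem hrot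
  have hmem (x : V × V) : x ∈ ((FinEnum.toList V).filter P.init).product cyc ↔
      P.init x.1 = true ∧ x.2 ∈ cyc := by
    obtain ⟨u, v⟩ := x
    simp
  cases hm : (((FinEnum.toList V).filter P.init).product cyc).argmin
      (fun x => dist₀ P.graph x.1 x.2) with
  | none =>
    rw [List.argmin_eq_none] at hm
    have := (hmem (j, g)).2 ⟨hj, hgmem⟩
    simp [hm] at this
  | some x =>
    obtain ⟨hx1, hx2⟩ := (hmem x).1 (List.argmin_mem hm)
    have hle : dist₀ P.graph x.1 x.2 ≤ dist₀ P.graph j g :=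
      List.le_of_mem_argmin (f := fun x : V × V => dist₀ P.graph x.1 x.2)
        ((hmem (j, g)).2 ⟨hj, hgmem⟩) hm
    obtain ⟨e, he⟩ := WithTop.ne_top_iff_exists.1 (ne_top_of_le_ne_top hjg hle)
    have hpre := isPath_path₀ hA he.symm
    have hrot' : c.IsRotated (cyc.rotate (cyc.idxOf x.2)) := hrot.symm.trans ⟨_, rfl⟩
    have hhead : (cyc.rotate (cyc.idxOf x.2))[0]? = some x.2 := by
      rw [List.getElem?_rotate (List.length_pos_of_mem hx2), Nat.zero_add,
        Nat.mod_eq_of_lt (List.idxOf_lt_length_of_mem hx2), List.getElem?_idxOf hx2]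
    refine ⟨_, _, C, rfl, fun h => ?_, fun d => ?_, ?_⟩
    · simp [h] at hhead
    · obtain ⟨h1, h2, h3, h4⟩ := hwalk.lasso hA hAw hrot' hhead (List.mem_rotate.2 hgmem) hpre d
      exact ⟨by rw [h1, hx1], fun n => htrans _ _ (h2 n), ⟨g, hgacc, h3⟩, h4⟩
    · exact fun i f s₁ s₂ hi hif hf => hmin f s₁ s₂ ((hF' f).2 ⟨hf, i, hi, hif⟩)

end Product

/-! ### Costs of runs -/

namespace WTS

variable {Q AP : Type*}

/-- The position of the `i`-th occurrence of `π`. -/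
noncomputable def occurrence (T : WTS Q AP ℝ) (π : AP) (r : ℕ → Q) (i : ℕ) : ℕ :=
  Nat.nth (fun n => π ∈ T.L (r n)) i

theorem time_sub_time (T : WTS Q AP ℝ) (r : ℕ → Q) {n m : ℕ} (h : n ≤ m) :
    T.time r m - T.time r n = seqLength T.w r n m :=
  (Finset.sum_Ico_eq_sub _ h).symm

variable {T : WTS Q AP ℝ} {π : AP} {r : ℕ → Q}

theorem infinite_occurrences (h : ∃ᶠ n in atTop, π ∈ T.L (r n)) :
    (Set.ofPred fun n => π ∈ T.L (r n)).Infinite :=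
  Nat.frequently_atTop_iff_infinite.1 h

theorem occurrence_strictMono (h : ∃ᶠ n in atTop, π ∈ T.L (r n)) :
    StrictMono (T.occurrence π r) :=
  Nat.nth_strictMono (infinite_occurrences h)

theorem mem_occurrence (h : ∃ᶠ n in atTop, π ∈ T.L (r n)) (i : ℕ) :
    π ∈ T.L (r (T.occurrence π r i)) :=
  Nat.nth_mem_of_infinite (infinite_occurrences h) i

theorem le_occurrence {i n : ℕ} (h : n < T.occurrence π r (i + 1)) (hn : π ∈ T.L (r n)) :
    n ≤ T.occurrence π r i :=
  Nat.le_nth_of_lt_nth_succ h hn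

theorem cost_eq (h : ∃ᶠ n in atTop, π ∈ T.L (r n)) :
    T.cost π r = limsup (fun i => ((seqLength T.w r (T.occurrence π r i)
      (T.occurrence π r (i + 1)) : ℝ) : EReal)) atTop := by
  unfold cost propTime
  congr 1
  funext i
  rw [← time_sub_time T r (occurrence_strictMono h (Nat.lt_succ_self i)).le]
  rfl

/-- If eventually, from every position of a run, `π` holds again within time `C`, then the cost of
the run is at most `C`. -/
theorem cost_le (hr : T.IsRun r) (h : ∃ᶠ n in atTop, π ∈ T.L (r n)) {C : ℝ}
    (hC : ∀ᶠ n in atTop, ∃ m > n, π ∈ T.L (r m) ∧ seqLength T.w r n m ≤ C) :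
    T.cost π r ≤ C := by
  rw [cost_eq h]
  refine limsup_le_of_le (h := ?_)
  filter_upwards [(occurrence_strictMono h).tendsto_atTop.eventually hC] with i hi
  obtain ⟨m, hm, hm1, hm2⟩ := hi
  rw [EReal.coe_le_coe_iff]
  refine le_trans ?_ hm2
  have hle : T.occurrence π r (i + 1) ≤ m := by
    by_contra hlt
    exact absurd (le_occurrence (not_le.1 hlt) hm1) (not_le.2 hm)
  rw [← seqLength_add T.w r (occurrence_strictMono h (Nat.lt_succ_self i)).le hle]
  exact le_add_of_nonneg_right (seqLength_nonneg fun j _ _ => (T.w_pos _ _ (hr.2 j)).le)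

end WTS

/-! ### Correctness of Optimal-Run -/

section Correctness

variable {AP Q S : Type*} [DecidableEq AP] [FinEnum Q] [FinEnum S] {T : WTS Q AP ℝ} {ϕ : LTL AP}
  {π : AP} {B : BuchiAutomaton S (Finset AP)}

theorem productAutomaton_w_nonneg (u v : Q × S)
    (h : (productAutomaton T π B).trans u v = true) : 0 ≤ (productAutomaton T π B).w u v :=
  (T.w_pos _ _ (of_decide_eq_true h).1).le

/-- A satisfying run whose times between successive occurrences of `π` are eventually less than `M`
yields a triple of cost less than `M`. -/
theorem exists_tripleCost_lt_of_isSatisfyingRun (hB : B.Recognizes (LTL.spec ϕ π)) {r : ℕ → Q}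
    (hr : T.IsSatisfyingRun (LTL.spec ϕ π) r) {N : ℕ} {M : WithTop ℝ}
    (hM : ∀ i ≥ N, (seqLength T.w r (T.occurrence π r i) (T.occurrence π r (i + 1)) : WithTop ℝ)
      < M) :
    ∃ i f s₁ s₂, (productAutomaton T π B).init i = true ∧
      dist₀ (productAutomaton T π B).graph i f ≠ ⊤ ∧ (productAutomaton T π B).acc f = true ∧
      (productAutomaton T π B).prop s₁ = true ∧ (productAutomaton T π B).prop s₂ = true ∧
      tripleCost (productAutomaton T π B).graph (productAutomaton T π B).prop (f, s₁, s₂) < M := by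
  obtain ⟨hrun, hsat⟩ := hr
  have hocc : ∃ᶠ n in atTop, π ∈ T.L (r n) := ((LTL.sat_spec_iff _ _ _).1 hsat).2
  obtain ⟨ρ, ⟨hρ0, hρ⟩, a, ha, hfreq⟩ := (hB _).2 hsat
  obtain ⟨q, hq⟩ := exists_frequently_of_frequently_exists
    (p := fun n q => (r n, ρ n) = (q, a)) (hfreq.mono fun n hn => ⟨r n, by rw [hn]⟩)
  have htrans (n : ℕ) :
      (productAutomaton T π B).trans (r n, ρ n) (r (n + 1), ρ (n + 1)) = true :=
    decide_eq_true ⟨hrun.2 n, hρ n⟩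
  have hA := (productAutomaton T π B).graph_nonneg productAutomaton_w_nonneg
  have hτ (n : ℕ) : (productAutomaton T π B).graph (r n, ρ n) (r (n + 1), ρ (n + 1)) =
      (productAutomaton T π B).w (r n, ρ n) (r (n + 1), ρ (n + 1)) := if_pos (htrans n)
  obtain ⟨s₁, s₂, hs₁, hs₂, hlt⟩ := exists_tripleCost_lt hA (τ := fun n => (r n, ρ n)) hτ
    (S := (productAutomaton T π B).prop) (WTS.occurrence_strictMono hocc)
    (fun i => decide_eq_true (WTS.mem_occurrence hocc i))
    (fun i n h hn => WTS.le_occurrence h (of_decide_eq_true hn)) hq hM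
  refine ⟨(r 0, ρ 0), (q, a), s₁, s₂, decide_eq_true ⟨hrun.1, hρ0⟩, ?_, decide_eq_true ha,
    hs₁, hs₂, hlt⟩
  obtain ⟨n, hn, hnf⟩ := frequently_atTop.1 hq 1
  unfold dist₀
  split_ifs
  · exact WithTop.zero_ne_top
  · rw [← hnf]
    exact ne_top_of_le_ne_top WithTop.coe_ne_top
      (shortestPath_le_seqLength hA (τ := fun n => (r n, ρ n)) hτ hn)

theorem lasso_map {V W : Type*} (g : V → W) (d : V) (pre cyc : List V) (n : ℕ) :
    lasso (g d) (pre.map g) (cyc.map g) n = g (lasso d pre cyc n) := by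
  unfold lasso
  simp only [List.length_map, List.getD_map]
  split_ifs <;> rfl

theorem isSolution_optimalRunOf (hB : B.Recognizes (LTL.spec ϕ π))
    (hex : ∃ r, T.IsSatisfyingRun (LTL.spec ϕ π) r) :
    IsSolution T ϕ π (optimalRunOf T π B) := by
  obtain ⟨r₀, hr₀⟩ := hex
  obtain ⟨i, f, s₁, s₂, hi, hif, hf, hs₁, hs₂, hlt⟩ :=
    exists_tripleCost_lt_of_isSatisfyingRun hB hr₀ (N := 0) (M := ⊤)
      (fun i _ => WithTop.coe_lt_top _)
  obtain ⟨pre, cyc, C, hout, hcyc, hrun, hmin⟩ := optimalProductRun_eq_some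
    (productAutomaton T π B) productAutomaton_w_nonneg hi hif hf hs₁ hs₂ hlt
  obtain ⟨h0, htrans, ⟨g, hg, hfreq⟩, hgap⟩ := hrun (T.q₀, f.2)
  have hproj (n : ℕ) := lasso_map Prod.fst (T.q₀, f.2) pre cyc n
  generalize lasso (T.q₀, f.2) pre cyc = τ at h0 htrans hfreq hgap hproj
  have hfun : lasso T.q₀ (pre.map Prod.fst) (cyc.map Prod.fst) = fun n => (τ n).1 :=
    funext hproj
  refine ⟨pre.map Prod.fst, cyc.map Prod.fst, by simp [optimalRunOf, hout], by simpa using hcyc, ?_⟩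
  rw [hfun]
  have hτ0 := of_decide_eq_true h0
  have hτ (n : ℕ) := of_decide_eq_true (htrans n)
  have hisRun : T.IsRun fun n => (τ n).1 := ⟨hτ0.1, fun n => (hτ n).1⟩
  have hsat : LTL.Sat (T.word fun n => (τ n).1) (LTL.spec ϕ π) :=
    (hB _).1 ⟨fun n => (τ n).2, ⟨hτ0.2, fun n => (hτ n).2⟩, g.2, of_decide_eq_true hg,
      hfreq.mono fun n hn => congrArg Prod.snd hn⟩
  refine ⟨⟨hisRun, hsat⟩, fun r hr => ?_⟩
  have hcost : T.cost π (fun n => (τ n).1) ≤ C :=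
    WTS.cost_le hisRun ((LTL.sat_spec_iff _ _ _).1 hsat).2 (hgap.mono fun n hn => by
      obtain ⟨m, hm, hm1, hm2⟩ := hn
      exact ⟨m, hm, of_decide_eq_true hm1, hm2⟩)
  refine hcost.trans (not_lt.1 fun hlt => ?_)
  rw [WTS.cost_eq ((LTL.sat_spec_iff _ _ _).1 hr.2).2] at hlt
  obtain ⟨N, hN⟩ := eventually_atTop.1 (eventually_lt_of_limsup_lt hlt)
  obtain ⟨i, f, s₁, s₂, hi, hif, hf, hs₁, hs₂, hlt'⟩ :=
    exists_tripleCost_lt_of_isSatisfyingRun hB hr (N := N) (M := C)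
      (fun i hi => WithTop.coe_lt_coe.2 (EReal.coe_lt_coe_iff.1 (hN i hi)))
  exact absurd (hmin i f s₁ s₂ hi hif hf hs₁ hs₂) (not_le.2 hlt')

end Correctness

/-- Correctness of Optimal-Run. The translation of formulas into Büchi automata is correct; and if
some run satisfies `ϕ ∧ G F π`, then Optimal-Run outputs a satisfying run of least cost, with this
translation and with any other correct one. -/
theorem mainTheorem1 {AP Q : Type*} [Fintype AP] [DecidableEq AP] [FinEnum Q]
    (T : WTS Q AP ℝ) (ϕ : LTL AP) (π : AP) :
    (∀ ψ : LTL AP, ψ.toBuchi.Recognizes ψ) ∧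
    ((∃ r, T.IsSatisfyingRun (LTL.spec ϕ π) r) →
      IsSolution T ϕ π (optimalRun T ϕ π) ∧
      ∀ (S : Type*) [FinEnum S] (B : BuchiAutomaton S (Finset AP)),
        B.Recognizes (LTL.spec ϕ π) → IsSolution T ϕ π (optimalRunOf T π B)) :=
  ⟨LTL.toBuchi_recognizes, fun hex =>
    ⟨isSolution_optimalRunOf (LTL.toBuchi_recognizes _) hex,
      fun _ _ _ hB => isSolution_optimalRunOf hB hex⟩⟩
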